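/- Let $n\ge 1$ be an integer and $\lambda\in\{1,-1\}$. Let $\mathrm{Mat}_*(2,\mathbb Z)$ be the monoid of integral $2\times 2$ matrices with nonzero determinant, $\mathcal R=\mathbb Z[\mathrm{Mat}_*(2,\mathbb Z)]$ the ring of finite formal $\mathbb Z$-linear combinations of such matrices, and $$I=\begin{pmatrix}1&0\\0&1\end{pmatrix},\quad M=\begin{pmatrix}0&1\\1&0\end{pmatrix},\quad T=\begin{pmatrix}1&1\\0&1\end{pmatrix},\quad Q=\begin{pmatrix}0&-1\\1&0\end{pmatrix}.$$ Let $\bar\Gamma_0(n)=\{\begin{pmatrix}a&b\\c&d\end{pmatrix}\in \mathrm{GL}(2,\mathbb Z): n\mid c\}$ and $I_n=\bar\Gamma_0(n)\backslash \mathrm{GL}(2,\mathbb Z)$, on which $\mathrm{GL}(2,\mathbb Z)$ acts from the right. For integers $x,y$ let $[x:y]$ be the class of $(x,y)$ under the relation: $(x,y)\sim(x',y')$ if $kx\equiv x'$ and $ky\equiv y' \pmod n$ for some integer $k$ coprime to $n$. A coset $i=\bar\Gamma_0(n)\begin{pmatrix}a&b\\c&d\end{pmatrix}$ is identified with $[c:d]$.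 Call a pair $(c,b)$ with $c\ge1$, $c\mid n$, $0\le b<n/c$ admissible if $\gcd(c,b+k\frac nc)=1$ for some $0\le k<c$, and then let $d(c,b)$ be the least of the numbers $c+b+k\frac nc$ with $0\le k<c$ and $\gcd(c,b+k\frac nc)=1$. For every $i\in I_n$ there is exactly one admissible pair $(c,b)$ with $i=[c:d(c,b)]$; put $A_i=\begin{pmatrix}c&b\\0&n/c\end{pmatrix}$. Let $$S_n=\left\{\begin{pmatrix}a&b\\c&d\end{pmatrix}: a>c\ge0,\ d>b\ge0,\ ad-bc=n\right\},\qquad Y_n=\left\{\begin{pmatrix}c&0\\a&n/c\end{pmatrix}: c\mid n,\ 0\le a<c\right\},$$ and for $A=\begin{pmatrix}a&b\\c&d\end{pmatrix}\in S_n\setminus Y_n$ put $K(A)=T^{\lceil d/b\rceil}QA\in S_n$. For every $i\in I_n$ there is exactly one $k_i\ge0$ such that $K^j(A_i)$ is well-defined for all $j\le k_i$ (that is, $K^j(A_i)\in S_n\setminus Y_n$ for $j<k_i$) and $K^{k_i}(A_i)\in Y_n$. Put $$\psi_i=\sum_{j=0}^{k_i}K^j(A_i)\in\mathcal R .$$ (1)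 The family $(\psi_i)_{i\in I_n}$ satisfies $$\psi_i-\psi_{iT^{-1}}\,T-\lambda\,\psi_{iT^{-1}M}\,TM\in (I-T-\lambda TM)\mathcal R\qquad\text{for all } i\in I_n .$$ (2) Let $s\in\mathbb C$ and let $\phi$ be holomorphic in $\mathbb C\setminus(-\infty,0]$ with $$\phi(z)=\phi(z+1)+\lambda z^{-2s}\phi\left(1+\tfrac1z\right)\qquad (z\in\mathbb C\setminus(-\infty,0]).$$ For a matrix $A=\begin{pmatrix}a&b\\c&d\end{pmatrix}$ with nonzero determinant put $(\phi|_sA)(z)=|\det A|^s(cz+d)^{-2s}\phi\left(\frac{az+b}{cz+d}\right)$ (principal branch of powers), which is said to be defined if either $c>0$, or $c=0$ and $a,d>0$, and if moreover $a-cr>0$ for some real $r$ such that $\phi$ is holomorphic in $\mathbb C\setminus(-\infty,r]$; extend this linearly to combinations of matrices. Then $\phi|_sA$ is defined for every matrix $A$ occurring in any $\psi_i$, and the functions $\phi_i=\phi|_s\psi_i$ $(i\in I_n)$ are holomorphic in $\mathbb C\setminus(-\infty,0]$ and satisfy $$\phi_i(z)-\phi_{iT^{-1}}(z+1)-\lambda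 z^{-2s}\phi_{iT^{-1}M}\left(1+\tfrac1z\right)=0\qquad (i\in I_n,\ z\in\mathbb C\setminus(-\infty,0]).$$ -/

import Mathlib

open scoped MatrixGroups MonoidAlgebra

namespace ModularLewis

noncomputable section

/-! ### Matrices and the ring of formal integer combinations -/

/-- The multiplicative monoid of integral `2 × 2` matrices with nonzero determinant. -/
def MatStar : Submonoid (Matrix (Fin 2) (Fin 2) ℤ) where
  carrier := {A | A.det ≠ 0}
  one_mem' := by simp
  mul_mem' := by
    intro A B hA hB
    simp only [Set.mem_ofPred_eq, Matrix.det_mul] at *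
    exact mul_ne_zero hA hB

/-- `GL(2, ℤ)` sits inside the monoid of integral matrices with nonzero determinant. -/
def ofGL (g : GL (Fin 2) ℤ) : MatStar :=
  ⟨(g : Matrix (Fin 2) (Fin 2) ℤ), by
    have h : IsUnit (g : Matrix (Fin 2) (Fin 2) ℤ).det :=
      (Matrix.isUnit_iff_isUnit_det _).1 g.isUnit
    exact h.ne_zero⟩

def matM : GL (Fin 2) ℤ :=
  ⟨!![0, 1; 1, 0], !![0, 1; 1, 0], by decide, by decide⟩

def matT : GL (Fin 2) ℤ :=
  ⟨!![1, 1; 0, 1], !![1, -1; 0, 1], by decide, by decide⟩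

def matQ : GL (Fin 2) ℤ :=
  ⟨!![0, -1; 1, 0], !![0, 1; -1, 0], by decide, by decide⟩

/-- The ring `ℤ[Mat_*(2, ℤ)]` of finite formal `ℤ`-linear combinations of integral matrices with
nonzero determinant; the product extends matrix multiplication bilinearly. -/
abbrev MatRing : Type := MonoidAlgebra ℤ MatStar

/-- A matrix regarded as an element of the ring of formal combinations. -/
def single (A : MatStar) : MatRing := MonoidAlgebra.single A 1

/-- The right ideal `(I - T - lam T M) ℛ` of `ℛ = ℤ[Mat_*(2, ℤ)]`. -/
def lewisIdeal (lam : ℤ) : Submodule MatRingᵐᵒᵖ MatRing :=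
  Submodule.span MatRingᵐᵒᵖ
    {single (ofGL 1) - single (ofGL matT) - lam • single (ofGL (matT * matM))}

/-! ### The coset space `I_n` -/

/-- The group of matrices in `GL(2, ℤ)` whose lower left entry is divisible by `n`. -/
def Gamma0Bar (n : ℕ) : Subgroup (GL (Fin 2) ℤ) where
  carrier := {g | (n : ℤ) ∣ g 1 0}
  one_mem' := by simp
  mul_mem' := by
    intro g h hg hh
    simp only [Set.mem_ofPred_eq, Units.val_mul, Matrix.mul_apply, Fin.sum_univ_two] at *
    exact dvd_add (Dvd.dvd.mul_right hg _) (Dvd.dvd.mul_left hh _)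
  inv_mem' := by
    intro g hg
    simp only [Set.mem_ofPred_eq] at *
    rw [Matrix.coe_units_inv, Matrix.inv_def, Matrix.adjugate_fin_two]
    simp only [Matrix.smul_apply, smul_eq_mul, Matrix.of_apply, Matrix.cons_val_zero,
      Matrix.cons_val_one, Matrix.cons_val', Matrix.cons_val_fin_one]
    exact Dvd.dvd.mul_left (dvd_neg.2 hg) _

/-- The space `Γ̄₀(n) \ GL(2, ℤ)` of cosets `Γ̄₀(n) g`. -/
abbrev CosetSpace (n : ℕ) : Type := Quotient (QuotientGroup.rightRel (Gamma0Bar n))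

/-- The right action of `GL(2, ℤ)` on cosets: `(Γ̄₀(n) g, h) ↦ Γ̄₀(n) g h`. -/
def CosetSpace.act {n : ℕ} (i : CosetSpace n) (h : GL (Fin 2) ℤ) : CosetSpace n :=
  Quotient.map (fun g => g * h) (by
    intro g g' hgg
    have h1 := QuotientGroup.rightRel_apply.1 hgg
    refine QuotientGroup.rightRel_apply.2 ?_
    simpa [mul_assoc] using h1) i

/-- Pairs `(x, y)` and `(x', y')` of integers are equivalent if
`k x ≡ x'` and `k y ≡ y'` modulo `n` for some `k` coprime to `n`. -/
def ratioSetoid (n : ℕ) : Setoid (ℤ × ℤ) where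
  r p q := ∃ k : ℤ, IsCoprime k (n : ℤ) ∧
    k * p.1 ≡ q.1 [ZMOD n] ∧ k * p.2 ≡ q.2 [ZMOD n]
  iseqv := by
    refine ⟨fun p => ⟨1, isCoprime_one_left, by simp, by simp⟩, ?_, ?_⟩
    · rintro p q ⟨k, ⟨u, v, huv⟩, h1, h2⟩
      have hu : u * k ≡ 1 [ZMOD n] :=
        (Int.modEq_iff_dvd.2 ⟨v, by linear_combination -huv⟩)
      refine ⟨u, ⟨k, v, by linear_combination huv⟩, ?_, ?_⟩
      · calc u * q.1 ≡ u * (k * p.1) [ZMOD n] := (h1.mul_left u).symm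
          _ = (u * k) * p.1 := by ring
          _ ≡ 1 * p.1 [ZMOD n] := hu.mul_right _
          _ = p.1 := one_mul _
      · calc u * q.2 ≡ u * (k * p.2) [ZMOD n] := (h2.mul_left u).symm
          _ = (u * k) * p.2 := by ring
          _ ≡ 1 * p.2 [ZMOD n] := hu.mul_right _
          _ = p.2 := one_mul _
    · rintro p q r ⟨k, hk, h1, h2⟩ ⟨l, hl, h3, h4⟩
      refine ⟨l * k, hl.mul_left hk, ?_, ?_⟩
      · rw [mul_assoc]
        exact (h1.mul_left l).trans h3
      · rw [mul_assoc]
        exact (h2.mul_left l).trans h4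

/-- The class `[x : y]` of a pair of integers. -/
def ratio (n : ℕ) (x y : ℤ) : Quotient (ratioSetoid n) := Quotient.mk (ratioSetoid n) (x, y)

/-- The map sending the coset of a matrix with bottom row `(c, d)` to `[c : d]`. -/
def bottomRow (n : ℕ) (i : CosetSpace n) : Quotient (ratioSetoid n) :=
  Quotient.lift (fun g : GL (Fin 2) ℤ => ratio n (g 1 0) (g 1 1)) (by
    intro g g' hgg
    have h1 : (n : ℤ) ∣ (g' * g⁻¹ : GL (Fin 2) ℤ) 1 0 := QuotientGroup.rightRel_apply.1 hgg
    obtain ⟨h, hh⟩ : ∃ h : GL (Fin 2) ℤ, h = g' * g⁻¹ := ⟨_, rfl⟩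
    rw [← hh] at h1
    have hg : g' = h * g := by rw [hh]; simp
    have hdet : IsUnit (h : Matrix (Fin 2) (Fin 2) ℤ).det :=
      (Matrix.isUnit_iff_isUnit_det _).1 h.isUnit
    rw [Matrix.det_fin_two] at hdet
    obtain ⟨t, ht⟩ := h1
    obtain ⟨w, hw⟩ := hdet.exists_right_inv
    refine Quotient.sound ⟨h 1 1, ⟨h 0 0 * w, - h 0 1 * t * w, ?_⟩, ?_, ?_⟩
    · rw [ht] at hw
      linear_combination hw
    · refine Int.modEq_iff_dvd.2 ⟨t * g 0 0, ?_⟩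
      subst hg
      simp only [Units.val_mul, Matrix.mul_apply, Fin.sum_univ_two, ht]
      ring
    · refine Int.modEq_iff_dvd.2 ⟨t * g 0 1, ?_⟩
      subst hg
      simp only [Units.val_mul, Matrix.mul_apply, Fin.sum_univ_two, ht]
      ring) i

/-! ### The matrices `A_i` -/

/-- `(c, b)` is `n`-admissible: `c ∣ n`, `0 ≤ b < n / c`, and `gcd (c, b + k n / c) = 1` for some
`0 ≤ k < c`. -/
def Admissible (n : ℕ) (p : ℕ × ℕ) : Prop :=
  1 ≤ p.1 ∧ p.1 ∣ n ∧ p.2 < n / p.1 ∧ ∃ k < p.1, Nat.Coprime p.1 (p.2 + k * (n / p.1))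

/-- `d(c, b)`, the least `c + b + k n / c` with `0 ≤ k < c` and `gcd (c, b + k n / c) = 1`. -/
def dMin (n : ℕ) (p : ℕ × ℕ) : ℕ :=
  sInf {m | ∃ k < p.1, Nat.Coprime p.1 (p.2 + k * (n / p.1)) ∧ m = p.1 + p.2 + k * (n / p.1)}

/-- The admissible pair `(c, b)` belongs to the coset `i` if `i` corresponds to
`[c : d(c, b)]`. -/
def IsIndexPair (n : ℕ) (i : CosetSpace n) (p : ℕ × ℕ) : Prop :=
  Admissible n p ∧ bottomRow n i = ratio n p.1 (dMin n p)

/-- The admissible pair belonging to the coset `i`. -/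
def indexPair (n : ℕ) (i : CosetSpace n) : ℕ × ℕ := Classical.epsilon (IsIndexPair n i)

open Classical in
/-- The upper triangular matrix `A_i = (c, b; 0, n / c)`, where `(c, b)` is the admissible pair
belonging to `i`. (The other branch is never taken for an admissible pair and `n ≥ 1`.) -/
def matA (n : ℕ) (i : CosetSpace n) : MatStar :=
  if h : !![((indexPair n i).1 : ℤ), ((indexPair n i).2 : ℤ);
      0, ((n / (indexPair n i).1 : ℕ) : ℤ)] ∈ MatStar
  then ⟨_, h⟩ else 1

/-! ### The operator `K` and the chains -/

/-- The set `S_n`. -/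
def setS (n : ℕ) : Set MatStar :=
  {A | A.1 1 0 < A.1 0 0 ∧ 0 ≤ A.1 1 0 ∧ A.1 0 1 < A.1 1 1 ∧ 0 ≤ A.1 0 1 ∧ A.1.det = n}

/-- The set `Y_n` of lower triangular matrices `(c, 0; a, n / c)` with `c ∣ n`, `0 ≤ a < c`. -/
def setY (n : ℕ) : Set MatStar :=
  {A | ∃ c a : ℕ, c ∣ n ∧ a < c ∧ A.1 = !![(c : ℤ), 0; (a : ℤ), ((n / c : ℕ) : ℤ)]}

/-- The operator `K : (a, b; c, d) ↦ T ^ ⌈d / b⌉ Q (a, b; c, d)`. It is only used on `S_n \ Y_n`,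
where `b > 0`. -/
def opK (A : MatStar) : MatStar :=
  ofGL (matT ^ ⌈(A.1 1 1 : ℚ) / (A.1 0 1 : ℚ)⌉ * matQ) * A

/-- `k` is the number of steps of the chain starting in `A`: the iterates `K^j A`, `j ≤ k`, are
well-defined, i.e. `K^j A` lies in the domain `S_n \ Y_n` of `K` for all `j < k`, and
`K^k A ∈ Y_n`. -/
def IsChainLength (n : ℕ) (A : MatStar) (k : ℕ) : Prop :=
  (∀ j < k, opK^[j] A ∈ setS n \ setY n) ∧ opK^[k] A ∈ setY n

/-- The number `k_i` of the coset `i`. -/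
def chainLength (n : ℕ) (i : CosetSpace n) : ℕ := Classical.epsilon (IsChainLength n (matA n i))

/-- `ψ_i = ∑_{j = 0}^{k_i} K^j A_i`. -/
def psi (n : ℕ) (i : CosetSpace n) : MatRing :=
  ∑ j ∈ Finset.range (chainLength n i + 1), single (opK^[j] (matA n i))

/-! ### Slash operation -/

/-- `(φ |_s A)(z) = |det A|^s (c z + d)^(-2s) φ((a z + b) / (c z + d))`, with principal powers. -/
def slash (s : ℂ) (φ : ℂ → ℂ) (A : MatStar) (z : ℂ) : ℂ :=
  ((|A.1.det| : ℤ) : ℂ) ^ s * ((A.1 1 0 : ℂ) * z + (A.1 1 1 : ℂ)) ^ (-2 * s) *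
    φ (((A.1 0 0 : ℂ) * z + (A.1 0 1 : ℂ)) / ((A.1 1 0 : ℂ) * z + (A.1 1 1 : ℂ)))

/-- The slash operation, extended linearly to formal integer combinations of matrices. -/
def slashRing (s : ℂ) (φ : ℂ → ℂ) (R : MatRing) (z : ℂ) : ℂ :=
  R.coeff.sum fun A m => (m : ℂ) * slash s φ A z

/-- `r` is a branching point of `φ`: `φ` is holomorphic on `ℂ \ (-∞, r]`. -/
def IsBranchingPoint (φ : ℂ → ℂ) (r : ℝ) : Prop :=
  DifferentiableOn ℂ φ {z : ℂ | r < z.re ∨ z.im ≠ 0}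

/-- The slash operation of `A = (a, b; c, d)` on `φ` is defined: `c > 0`, or `c = 0` and
`a, d > 0`; and `a - c r > 0` for some branching point `r` of `φ`. -/
def SlashDefined (φ : ℂ → ℂ) (A : MatStar) : Prop :=
  (0 < A.1 1 0 ∨ (A.1 1 0 = 0 ∧ 0 < A.1 0 0 ∧ 0 < A.1 1 1)) ∧
    ∃ r : ℝ, IsBranchingPoint φ r ∧ 0 < (A.1 0 0 : ℝ) - (A.1 1 0 : ℝ) * r

/-! ### The Lewis equations -/

/-- `φ` is a solution of the scalar Lewis equation of weight `s` for `PSL(2, ℤ)`, holomorphic in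
`ℂ \ (-∞, 0]`. -/
def IsScalarSolution (lam : ℤ) (s : ℂ) (φ : ℂ → ℂ) : Prop :=
  DifferentiableOn ℂ φ Complex.slitPlane ∧
    ∀ z ∈ Complex.slitPlane,
      φ z = φ (z + 1) + (lam : ℂ) * z ^ (-2 * s) * φ (1 + 1 / z)

/-- `(φ_i)` is a solution of the vector Lewis equation of weight `s` for `Γ̄₀(n)`, with components
holomorphic in `ℂ \ (-∞, 0]`. -/
def IsVectorSolution (n : ℕ) (lam : ℤ) (s : ℂ) (φ : CosetSpace n → ℂ → ℂ) : Prop :=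
  ∀ i : CosetSpace n, DifferentiableOn ℂ (φ i) Complex.slitPlane ∧
    ∀ z ∈ Complex.slitPlane,
      φ i z - φ (i.act matT⁻¹) (z + 1)
        - (lam : ℂ) * z ^ (-2 * s) * φ (i.act (matT⁻¹ * matM)) (1 + 1 / z) = 0

/-- `(ψ_i)` solves the system `ψ_i - ψ_{i T⁻¹} T - lam ψ_{i T⁻¹ M} T M ≡ 0` modulo the right
ideal `(I - T - lam T M) ℛ`. -/
def IsModuleSolution (n : ℕ) (lam : ℤ) (ψ : CosetSpace n → MatRing) : Prop :=
  ∀ i : CosetSpace n,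
    ψ i - ψ (i.act matT⁻¹) * single (ofGL matT)
      - lam • (ψ (i.act (matT⁻¹ * matM)) * single (ofGL (matT * matM))) ∈ lewisIdeal lam

end

end ModularLewis

open ModularLewis

namespace ModularLewis

/-! Let (x, y) be the bottom row of g and L = ℤ(x, y - x) + nℤ², a lattice of index n in ℤ². A
matrix of determinant n satisfies `InClass n x (y - x)` exactly when its rows form a basis of L. The
operator K keeps this lattice, and on matrices of S_n with positive lower left entry it can be
undone inside S_n. Undoing it lowers the upper left entry until an upper triangular matrix is
reached, and L has only one such basis in S_n, namely A_i. Hence the chain of A_i runs through all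
bases of L in S_n, each once, and ψ_i is the sum over this finite set (`psi_eq_sum`).

The module equation thereby becomes a statement about finite sets. Write S, S', S'' for the sets
belonging to i, iT⁻¹, iT⁻¹M, and let W be the set of bases of L that satisfy the inequalities of S_n
with the two off-diagonal entries exchanged. A pointwise count (`transpose_indicator_identity`)
gives, as sums of matrices, S + TW + MTM·W = W + S'T + M·S''·TM. Since λ² = 1, the ideal contains λC
- MC and C - TC - MTM·C; these two relations turn the identity into the assertion
(`sum_sub_mem_nonnegIdeal`).

For the analytic part, membership in the right ideal is too weak: applying φ|_s to a multiple (I - T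
- λTM)C is justified when C has nonnegative entries, because then all points stay in the slit plane
and the principal powers multiply correctly (`cpow_num_eq`). All matrices C used above have
nonnegative entries, so membership is proved in the additive group `nonnegIdeal`, which lies in the
ideal and is annihilated by φ|_s. -/

/-! ### Classes of integral matrices under left multiplication by `GL(2, ℤ)` -/

/-- `n` divides the determinants of the rows of `A` with `(x, y)`. For `(x, y)` the bottom row of
`g` in `GL(2, ℤ)` and `|det A| = n` this says that `A ∈ GL(2, ℤ) diag(n, 1) g`. -/
def InClass (n : ℕ) (x y : ℤ) (A : MatStar) : Prop :=
  (n : ℤ) ∣ A.1 0 0 * y - A.1 0 1 * x ∧ (n : ℤ) ∣ A.1 1 0 * y - A.1 1 1 * x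

theorem matStar_ext {A B : MatStar} (h00 : A.1 0 0 = B.1 0 0) (h01 : A.1 0 1 = B.1 0 1)
    (h10 : A.1 1 0 = B.1 1 0) (h11 : A.1 1 1 = B.1 1 1) : A = B := by
  apply Subtype.ext
  ext i j
  fin_cases i <;> fin_cases j <;> assumption

theorem setS_iff {n : ℕ} {A : MatStar} : A ∈ setS n ↔
    A.1 1 0 < A.1 0 0 ∧ 0 ≤ A.1 1 0 ∧ A.1 0 1 < A.1 1 1 ∧ 0 ≤ A.1 0 1 ∧
      A.1 0 0 * A.1 1 1 - A.1 0 1 * A.1 1 0 = n := by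
  rw [← Matrix.det_fin_two]
  rfl

theorem mem_setY_iff {n : ℕ} {A : MatStar} (hA : A ∈ setS n) : A ∈ setY n ↔ A.1 0 1 = 0 := by
  obtain ⟨h1, h2, h3, h4, h5⟩ := setS_iff.1 hA
  constructor
  · rintro ⟨c, a, -, -, h⟩
    rw [h]
    rfl
  · intro h
    rw [h, zero_mul, sub_zero] at h5
    obtain ⟨a, ha⟩ := Int.eq_ofNat_of_zero_le (show 0 ≤ A.1 0 0 by omega)
    obtain ⟨c, hc⟩ := Int.eq_ofNat_of_zero_le h2
    obtain ⟨d, hd⟩ := Int.eq_ofNat_of_zero_le (show 0 ≤ A.1 1 1 by omega)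
    have hn : n = a * d := by
      rw [ha, hd] at h5
      exact_mod_cast h5.symm
    have ha0 : 0 < a := by omega
    refine ⟨a, c, ⟨d, hn⟩, by omega, ?_⟩
    rw [hn, Nat.mul_div_cancel_left _ ha0]
    ext i j
    fin_cases i <;> fin_cases j <;> assumption

/-! ### The operator `K` -/

theorem coe_matT_zpow (m : ℤ) :
    ((matT ^ m : GL (Fin 2) ℤ) : Matrix (Fin 2) (Fin 2) ℤ) = !![1, m; 0, 1] := by
  induction m using Int.induction_on with
  | zero => simp [Matrix.one_fin_two]
  | succ k ih =>
    rw [zpow_add_one, Units.val_mul, ih]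
    simp [matT, add_comm]
  | pred k ih =>
    rw [zpow_sub_one, Units.val_mul, ih]
    have : ((matT⁻¹ : GL (Fin 2) ℤ) : Matrix (Fin 2) (Fin 2) ℤ) = !![1, -1; 0, 1] := rfl
    rw [this]
    simp [sub_eq_add_neg, add_comm]

theorem opK_val (A : MatStar) : (opK A).1 =
    !![⌈(A.1 1 1 : ℚ) / (A.1 0 1 : ℚ)⌉ * A.1 0 0 - A.1 1 0,
      ⌈(A.1 1 1 : ℚ) / (A.1 0 1 : ℚ)⌉ * A.1 0 1 - A.1 1 1; A.1 0 0, A.1 0 1] := by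
  have hQ : ((matQ : GL (Fin 2) ℤ) : Matrix (Fin 2) (Fin 2) ℤ) = !![0, -1; 1, 0] := rfl
  have h : (opK A).1 = (matT ^ ⌈(A.1 1 1 : ℚ) / (A.1 0 1 : ℚ)⌉ * matQ : GL (Fin 2) ℤ).1 * A.1 := rfl
  rw [h, Units.val_mul, coe_matT_zpow, hQ, Matrix.eta_fin_two A.1]
  ext i j
  fin_cases i <;> fin_cases j <;> simp <;> ring

theorem ceil_div_bounds {b d : ℤ} (hb : 0 < b) :
    d ≤ ⌈(d : ℚ) / (b : ℚ)⌉ * b ∧ (⌈(d : ℚ) / (b : ℚ)⌉ - 1) * b < d := by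
  have hb' : (0 : ℚ) < b := by exact_mod_cast hb
  constructor
  · have := Int.le_ceil ((d : ℚ) / (b : ℚ))
    rw [div_le_iff₀ hb'] at this
    exact_mod_cast this
  · have := Int.ceil_lt_add_one ((d : ℚ) / (b : ℚ))
    rw [← sub_lt_iff_lt_add, lt_div_iff₀ hb'] at this
    exact_mod_cast this

theorem ceil_div_eq {b d m : ℤ} (hb : 0 < b) (h1 : d ≤ m * b) (h2 : (m - 1) * b < d) :
    ⌈(d : ℚ) / (b : ℚ)⌉ = m := by
  have hb' : (0 : ℚ) < b := by exact_mod_cast hb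
  rw [Int.ceil_eq_iff, lt_div_iff₀ hb', div_le_iff₀ hb']
  exact ⟨by exact_mod_cast h2, by exact_mod_cast h1⟩

theorem opK_mem_setS {n : ℕ} {A : MatStar} (hA : A ∈ setS n) (hb : 0 < A.1 0 1) :
    opK A ∈ setS n := by
  obtain ⟨h1, h2, h3, h4, h5⟩ := setS_iff.1 hA
  obtain ⟨h6, h7⟩ := ceil_div_bounds (d := A.1 1 1) hb
  rw [setS_iff, opK_val]
  generalize ⌈(A.1 1 1 : ℚ) / (A.1 0 1 : ℚ)⌉ = m at *
  simp only [Matrix.of_apply, Matrix.cons_val_zero, Matrix.cons_val_one, Matrix.cons_val',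
    Matrix.cons_val_fin_one]
  -- The quotient d / b exceeds 1. With m ≥ 2 the new upper left entry satisfies ma - c ≥ a + (a -
  -- c) > a.
  have hm : 2 ≤ m := by
    by_contra hm
    nlinarith
  refine ⟨by nlinarith, by omega, by linarith, by omega, by linarith⟩

theorem opK_inClass {n : ℕ} {x y : ℤ} {A : MatStar} (hA : InClass n x y A) :
    InClass n x y (opK A) := by
  obtain ⟨h1, h2⟩ := hA
  rw [InClass, opK_val]
  simp only [Matrix.of_apply, Matrix.cons_val_zero, Matrix.cons_val_one, Matrix.cons_val',
    Matrix.cons_val_fin_one]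
  refine ⟨?_, h1⟩
  generalize ⌈(A.1 1 1 : ℚ) / (A.1 0 1 : ℚ)⌉ = m
  exact (dvd_sub (h1.mul_left m) h2).trans (dvd_of_eq (by ring))

/-- The inverse step of K. The exponent m must be recovered from A alone: it is ⌈a / c⌉, which makes
the lower left entry mc - a of (T^m Q)⁻¹A lie in [0, c). The drop in the upper left entry drives the
descent to an upper triangular matrix. -/
theorem exists_opK_eq {n : ℕ} {x y : ℤ} {A : MatStar} (hA : A ∈ setS n) (hcl : InClass n x y A)
    (hc : 0 < A.1 1 0) :
    ∃ B ∈ setS n, InClass n x y B ∧ 0 < B.1 0 1 ∧ B.1 0 0 < A.1 0 0 ∧ opK B = A := by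
  obtain ⟨h1, h2, h3, h4, h5⟩ := setS_iff.1 hA
  obtain ⟨h6, h7⟩ := ceil_div_bounds (d := A.1 0 0) hc
  obtain ⟨m, hm⟩ : ∃ m, m = ⌈(A.1 0 0 : ℚ) / (A.1 1 0 : ℚ)⌉ := ⟨_, rfl⟩
  rw [← hm] at h6 h7
  have hm2 : 2 ≤ m := by
    by_contra hm
    nlinarith
  have hdet : (!![A.1 1 0, A.1 1 1; m * A.1 1 0 - A.1 0 0, m * A.1 1 1 - A.1 0 1]).det = n := by
    rw [Matrix.det_fin_two_of]
    linarith
  have hn : (n : ℤ) ≠ 0 := by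
    rw [← h5, ← Matrix.det_fin_two]
    exact A.2
  let B : MatStar := ⟨!![A.1 1 0, A.1 1 1; m * A.1 1 0 - A.1 0 0, m * A.1 1 1 - A.1 0 1], by
    change _ ≠ _
    rwa [hdet]⟩
  have h00 : B.1 0 0 = A.1 1 0 := rfl
  have h01 : B.1 0 1 = A.1 1 1 := rfl
  have h10 : B.1 1 0 = m * A.1 1 0 - A.1 0 0 := rfl
  have h11 : B.1 1 1 = m * A.1 1 1 - A.1 0 1 := rfl
  -- (md - b) / d rounds up to m because 0 ≤ b < d, so K applied to B uses the same exponent.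
  have hceil : ⌈(B.1 1 1 : ℚ) / (B.1 0 1 : ℚ)⌉ = m := by
    apply ceil_div_eq
    · omega
    · rw [h11, h01]
      omega
    · rw [h11, h01]
      linarith
  refine ⟨B, ?_, ⟨?_, ?_⟩, by omega, by omega, ?_⟩
  · rw [setS_iff, h00, h01, h10, h11]
    exact ⟨by linarith, by omega, by nlinarith, by omega, by linarith⟩
  · rw [h00, h01]
    exact hcl.2
  · rw [h10, h11]
    exact (dvd_sub (hcl.2.mul_left m) hcl.1).trans (dvd_of_eq (by ring))
  · apply matStar_ext <;> rw [opK_val, hceil] <;> simp [h00, h01, h10, h11]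

/-! ### Upper triangular representatives -/

/-- Uniqueness of the Hermite normal form of a lattice. From n = cm ∣ mx follows c ∣ x, so c is
prime to y and c ∣ c'y gives c ∣ c'; by symmetry c = c'. Then b and b' agree modulo m, and both lie
in [0, m). -/
theorem upper_unique {n : ℕ} {x y : ℤ} (hxy : IsCoprime x y) {c b m c' b' m' : ℤ}
    (hc : 0 < c) (hb : 0 ≤ b) (hbm : b < m) (hcm : c * m = n)
    (h1 : (n : ℤ) ∣ c * y - b * x) (h2 : (n : ℤ) ∣ m * x)
    (hc' : 0 < c') (hb' : 0 ≤ b') (hbm' : b' < m') (hcm' : c' * m' = n)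
    (h1' : (n : ℤ) ∣ c' * y - b' * x) (h2' : (n : ℤ) ∣ m' * x) :
    c = c' ∧ b = b' ∧ m = m' := by
  have key : ∀ {c b m c' b' m' : ℤ}, 0 < c → b < m → 0 ≤ b → c * m = n →
      (n : ℤ) ∣ m * x → 0 < c' → c' * m' = n → (n : ℤ) ∣ c' * y - b' * x → c ∣ c' := by
    intro c b m c' b' m' hc hbm hb hcm h2 hc' hcm' h1'
    have hcx : c ∣ x := by
      rw [← hcm, mul_comm c m] at h2
      exact Int.dvd_of_mul_dvd_mul_left (by omega) h2
    have hcn : c ∣ (n : ℤ) := ⟨m, hcm.symm⟩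
    have h3 : c ∣ c' * y := by
      have := dvd_add (hcn.trans h1') (hcx.mul_left b')
      simpa using this
    exact (hxy.of_isCoprime_of_dvd_left hcx).dvd_of_dvd_mul_right h3
  have hcc : c = c' := by
    apply Int.dvd_antisymm hc.le hc'.le
    · exact key hc hbm hb hcm h2 hc' hcm' h1'
    · exact key hc' hbm' hb' hcm' h2' hc hcm h1
  subst hcc
  have hmm : m = m' := by
    apply mul_left_cancel₀ hc.ne'
    rw [hcm, hcm']
  subst hmm
  refine ⟨rfl, ?_, rfl⟩
  have hcx : c ∣ x := by
    rw [← hcm, mul_comm c m] at h2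
    exact Int.dvd_of_mul_dvd_mul_left (by omega) h2
  obtain ⟨x', rfl⟩ := hcx
  have h3 : c * m ∣ c * ((b - b') * x') := by
    rw [hcm]
    exact (dvd_sub h1' h1).trans (dvd_of_eq (by ring))
  have h4 : m ∣ (b - b') * x' := Int.dvd_of_mul_dvd_mul_left hc.ne' h3
  -- A common factor of m and x' divides y = (y - bx') + bx' as well as x.
  have hcop : IsCoprime m x' := by
    have h5 : m ∣ y - b * x' := by
      apply Int.dvd_of_mul_dvd_mul_left hc.ne'
      rw [hcm]
      exact h1.trans (dvd_of_eq (by ring))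
    obtain ⟨t, ht⟩ := h5
    obtain ⟨u, v, huv⟩ := hxy
    refine ⟨v * t, u * c + v * b, ?_⟩
    linear_combination huv - v * ht
  have h6 : m ∣ b - b' := hcop.dvd_of_dvd_mul_right h4
  have := Int.eq_zero_of_abs_lt_dvd h6 (abs_lt.2 ⟨by omega, by omega⟩)
  omega

/-- Every class contains at most one upper triangular matrix in `S_n`. -/
theorem eq_of_inClass_of_upper {n : ℕ} {x y : ℤ} (hxy : IsCoprime x y)
    {A B : MatStar} (hA : A ∈ setS n) (hB : B ∈ setS n) (hA0 : A.1 1 0 = 0) (hB0 : B.1 1 0 = 0)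
    (hAc : InClass n x y A) (hBc : InClass n x y B) : A = B := by
  obtain ⟨h1, h2, h3, h4, h5⟩ := setS_iff.1 hA
  obtain ⟨h1', h2', h3', h4', h5'⟩ := setS_iff.1 hB
  obtain ⟨h6, h7⟩ := hAc
  obtain ⟨h6', h7'⟩ := hBc
  rw [hA0] at h1 h5 h7
  rw [hB0] at h1' h5' h7'
  obtain ⟨e1, e2, e3⟩ := upper_unique hxy h1 h4 h3 (by linarith) h6
    (by simpa using h7) h1' h4' h3' (by linarith) h6' (by simpa using h7')
  exact matStar_ext e1 e2 (by rw [hA0, hB0]) e3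

/-! ### The pair `(c, b)` of a coset -/

theorem isCoprime_bottom (g : GL (Fin 2) ℤ) : IsCoprime (g 1 0) (g 1 1) := by
  have hdet : IsUnit (g : Matrix (Fin 2) (Fin 2) ℤ).det :=
    (Matrix.isUnit_iff_isUnit_det _).1 g.isUnit
  rw [Matrix.det_fin_two] at hdet
  obtain ⟨w, hw⟩ := hdet.exists_right_inv
  exact ⟨-g 0 1 * w, g 0 0 * w, by linear_combination hw⟩

theorem dMin_spec {n : ℕ} {p : ℕ × ℕ} (hp : Admissible n p) :
    ∃ k < p.1, Nat.Coprime p.1 (p.2 + k * (n / p.1)) ∧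
      dMin n p = p.1 + p.2 + k * (n / p.1) := by
  obtain ⟨-, -, -, k, hk, hcop⟩ := hp
  exact Nat.sInf_mem (s := {m | ∃ k < p.1, Nat.Coprime p.1 (p.2 + k * (n / p.1)) ∧
    m = p.1 + p.2 + k * (n / p.1)}) ⟨_, k, hk, hcop, rfl⟩

/-- With uc + vd = 1 and d' = d + mq, the multiplier 1 + mvq fixes c modulo n and sends d to d'
modulo n. It is prime to m by its form, and prime to c because its product with d is d' modulo c. So
the choice of k in d(c, b) does not affect the class. -/
theorem ratio_eq_ratio {n : ℕ} {c m d d' : ℤ} (hcm : c * m = n) (hd : IsCoprime c d)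
    (hd' : IsCoprime c d') (h : m ∣ d' - d) : ratio n c d = ratio n c d' := by
  obtain ⟨q, hq⟩ := h
  obtain ⟨u, v, huv⟩ := hd
  have hkd : (1 + m * (v * q)) * d = d' - c * (m * u * q) := by
    linear_combination m * q * huv - hq
  have hkc : IsCoprime (1 + m * (v * q)) c := by
    have h1 : IsCoprime (d' - c * (m * u * q)) c := by
      rw [sub_eq_add_neg, ← mul_neg]
      exact hd'.symm.add_mul_left_left _
    rw [← hkd] at h1
    exact h1.of_mul_left_left
  have hkm : IsCoprime (1 + m * (v * q)) m := isCoprime_one_left.add_mul_left_left _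
  refine Quotient.sound ⟨1 + m * (v * q), ?_, ?_, ?_⟩
  · rw [← hcm]
    exact hkc.mul_right hkm
  · refine Int.modEq_iff_dvd.2 ⟨-(v * q), ?_⟩
    rw [← hcm]
    ring
  · refine Int.modEq_iff_dvd.2 ⟨u * q, ?_⟩
    dsimp only
    rw [← hcm, hkd]
    ring

/-- These divisibilities put A_i into the class of (x, y - x). The shift by x comes from the summand
c in d(c, b) = c + b + km. -/
theorem IsIndexPair.dvd {n : ℕ} {g : GL (Fin 2) ℤ} {p : ℕ × ℕ}
    (h : IsIndexPair n (Quotient.mk _ g) p) :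
    (n : ℤ) ∣ p.1 * (g 1 1 - g 1 0) - p.2 * g 1 0 ∧ (n : ℤ) ∣ (n / p.1 : ℕ) * g 1 0 := by
  obtain ⟨hp, hrow⟩ := h
  obtain ⟨k, -, -, hd⟩ := dMin_spec hp
  obtain ⟨-, hdvd, -, -⟩ := hp
  have hcm : (p.1 : ℤ) * (n / p.1 : ℕ) = n := by exact_mod_cast Nat.mul_div_cancel' hdvd
  obtain ⟨l, -, h1, h2⟩ := Quotient.exact hrow.symm
  rw [hd] at h2
  generalize n / p.1 = m at *
  obtain ⟨u, hu⟩ := Int.modEq_iff_dvd.1 h1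
  obtain ⟨v, hv⟩ := Int.modEq_iff_dvd.1 h2
  dsimp only at hu hv
  push_cast at hv
  constructor
  · refine ⟨-p.1 * u + l * k + p.1 * v - p.2 * u, ?_⟩
    linear_combination (p.1 : ℤ) * hv - (p.1 : ℤ) * hu - p.2 * hu + l * k * hcm
  · refine ⟨l + m * u, ?_⟩
    linear_combination (m : ℤ) * hu + l * hcm

theorem exists_isIndexPair {n : ℕ} (hn : 0 < n) (i : CosetSpace n) :
    ∃ p : ℕ × ℕ, IsIndexPair n i p := by
  induction i using Quotient.inductionOn with | _ g
  -- Modulo n the entry x is a unit u times a divisor c of n; with v inverse to u, [x : y] = [c :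
  -- vy].
  obtain ⟨c, hcn, u, hu, hxu⟩ := ZMod.eq_unit_mul_divisor ((g 1 0 : ℤ) : ZMod n)
  have hxy := isCoprime_bottom g
  generalize hx : g 1 0 = x at *
  generalize hy : g 1 1 = y at *
  obtain ⟨v, hv⟩ := hu.exists_left_inv
  obtain ⟨u, rfl⟩ := ZMod.intCast_surjective u
  obtain ⟨v, rfl⟩ := ZMod.intCast_surjective v
  obtain ⟨t, ht⟩ : (n : ℤ) ∣ 1 - v * u := by
    rw [← Int.modEq_iff_dvd, ← ZMod.intCast_eq_intCast_iff]
    exact_mod_cast hv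
  obtain ⟨w, hw⟩ : (n : ℤ) ∣ u * c - x := by
    rw [← Int.modEq_iff_dvd, ← ZMod.intCast_eq_intCast_iff]
    exact_mod_cast hxu
  obtain ⟨m, rfl⟩ := hcn
  have hc : 0 < c := Nat.pos_of_mul_pos_right hn
  have hm : 0 < m := Nat.pos_of_mul_pos_left hn
  push_cast at ht hw
  have hcy : IsCoprime (c : ℤ) y :=
    hxy.of_isCoprime_of_dvd_left ⟨u - m * w, by linear_combination -hw⟩
  have hcv : IsCoprime (c : ℤ) v := ⟨m * t, u, by linear_combination -ht⟩
  -- Two divisions with remainder, by m and then by c, write vy - c as b + km plus a multiple of cm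
  -- = n.
  obtain ⟨b, hb⟩ := Int.eq_ofNat_of_zero_le
    (Int.emod_nonneg (v * y - c) (show (m : ℤ) ≠ 0 by omega))
  obtain ⟨k, hk⟩ := Int.eq_ofNat_of_zero_le
    (Int.emod_nonneg ((v * y - c) / m) (show (c : ℤ) ≠ 0 by omega))
  have hbm : b < m := by
    have := Int.emod_lt_of_pos (v * y - c) (show (0 : ℤ) < m by omega)
    omega
  have hkc : k < c := by
    have := Int.emod_lt_of_pos ((v * y - c) / m) (show (0 : ℤ) < c by omega)
    omega
  have hdec : v * y = c + b + k * m + c * (m * ((v * y - c) / m / c)) := by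
    have h1 := Int.emod_add_mul_ediv (v * y - c) m
    have h2 := Int.emod_add_mul_ediv ((v * y - c) / m) c
    rw [hb] at h1
    rw [hk] at h2
    linear_combination -h1 - m * h2
  have hcd : IsCoprime (c : ℤ) (v * y) := hcv.mul_right hcy
  have hcop : Nat.Coprime c (b + k * m) := by
    rw [← Nat.isCoprime_iff_coprime]
    obtain ⟨p, q, hpq⟩ := hcd
    refine ⟨p + q + q * (m * ((v * y - c) / m / c)), q, ?_⟩
    push_cast
    linear_combination hpq - q * hdec
  have hdiv : c * m / c = m := Nat.mul_div_cancel_left _ hc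
  have hadm : Admissible (c * m) (c, b) := by
    refine ⟨hc, ⟨m, rfl⟩, ?_, k, hkc, ?_⟩
    · simpa only [hdiv] using hbm
    · simpa only [hdiv] using hcop
  refine ⟨(c, b), hadm, ?_⟩
  obtain ⟨k', -, hcop', hd⟩ := dMin_spec hadm
  simp only [hdiv] at hcop' hd
  have hrow : bottomRow (c * m) (Quotient.mk _ g) = ratio (c * m) c (v * y) := by
    refine Quotient.sound ⟨v, ⟨u, t, by push_cast; linear_combination -ht⟩, ?_, ?_⟩
    · refine Int.modEq_iff_dvd.2 ⟨c * t + v * w, ?_⟩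
      dsimp only
      rw [hx]
      push_cast
      linear_combination c * ht + v * hw
    · dsimp only
      rw [hy]
  rw [hrow]
  refine ratio_eq_ratio (m := m) (by push_cast; rfl) hcd ?_ ?_
  · rw [hd, Nat.isCoprime_iff_coprime]
    rw [add_assoc]
    simpa using hcop'
  · rw [hd]
    refine ⟨k' - k - c * ((v * y - c) / m / c), ?_⟩
    push_cast
    linear_combination -hdec

theorem isIndexPair_unique {n : ℕ} {i : CosetSpace n} {p q : ℕ × ℕ}
    (hp : IsIndexPair n i p) (hq : IsIndexPair n i q) : p = q := by
  induction i using Quotient.inductionOn with | _ g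
  obtain ⟨h1, h2⟩ := hp.dvd
  obtain ⟨h1', h2'⟩ := hq.dvd
  obtain ⟨hc, hdvd, hb, -⟩ := hp.1
  obtain ⟨hc', hdvd', hb', -⟩ := hq.1
  have hcm : (p.1 : ℤ) * (n / p.1 : ℕ) = n := by exact_mod_cast Nat.mul_div_cancel' hdvd
  have hcm' : (q.1 : ℤ) * (n / q.1 : ℕ) = n := by exact_mod_cast Nat.mul_div_cancel' hdvd'
  -- `upper_unique` applies to the shifted pair (x, y - x), which is still coprime.
  have hxy : IsCoprime (g 1 0) (g 1 1 - g 1 0) := by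
    simpa [sub_eq_add_neg] using (isCoprime_bottom g).add_mul_left_right (-1)
  obtain ⟨e1, e2, -⟩ := upper_unique hxy (by omega) (by omega) (by omega) hcm h1 h2
    (by omega) (by omega) (by omega) hcm' h1' h2'
  exact Prod.ext (by omega) (by omega)

theorem indexPair_spec {n : ℕ} (hn : 0 < n) (i : CosetSpace n) :
    IsIndexPair n i (indexPair n i) :=
  Classical.epsilon_spec (exists_isIndexPair hn i)

theorem matA_val {n : ℕ} (hn : 0 < n) (i : CosetSpace n) :
    (matA n i).1 = !![((indexPair n i).1 : ℤ), ((indexPair n i).2 : ℤ);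
      0, ((n / (indexPair n i).1 : ℕ) : ℤ)] := by
  obtain ⟨⟨hc, hdvd, hb, -⟩, -⟩ := indexPair_spec hn i
  rw [matA, dif_pos]
  change _ ≠ _
  rw [Matrix.det_fin_two_of, mul_zero, sub_zero]
  exact_mod_cast (Nat.mul_div_cancel' hdvd).trans_ne hn.ne'

theorem matA_mem_setS {n : ℕ} (hn : 0 < n) (i : CosetSpace n) : matA n i ∈ setS n := by
  obtain ⟨⟨hc, hdvd, hb, -⟩, -⟩ := indexPair_spec hn i
  have hcm : ((indexPair n i).1 : ℤ) * (n / (indexPair n i).1 : ℕ) = n := by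
    exact_mod_cast Nat.mul_div_cancel' hdvd
  rw [setS_iff, matA_val hn]
  simp only [Matrix.of_apply, Matrix.cons_val_zero, Matrix.cons_val_one, Matrix.cons_val',
    Matrix.cons_val_fin_one]
  refine ⟨by omega, by omega, by omega, by omega, by linarith⟩

theorem matA_inClass {n : ℕ} (hn : 0 < n) (g : GL (Fin 2) ℤ) :
    InClass n (g 1 0) (g 1 1 - g 1 0) (matA n (Quotient.mk _ g)) := by
  obtain ⟨h1, h2⟩ := (indexPair_spec hn (Quotient.mk _ g)).dvd
  rw [InClass, matA_val hn]
  simp only [Matrix.of_apply, Matrix.cons_val_zero, Matrix.cons_val_one, Matrix.cons_val',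
    Matrix.cons_val_fin_one]
  exact ⟨h1, by simpa using h2⟩

/-! ### Chains -/

theorem isChainLength_unique {n : ℕ} {A : MatStar} {k l : ℕ} (hk : IsChainLength n A k)
    (hl : IsChainLength n A l) : k = l := by
  rcases lt_trichotomy k l with h | h | h
  · exact absurd hk.2 (hl.1 k h).2
  · exact h
  · exact absurd hl.2 (hk.1 l h).2

/-- K replaces the lower right entry d by b < d, so the chain stops, and it can only stop in Y_n. -/
theorem exists_isChainLength {n : ℕ} {A : MatStar} (hA : A ∈ setS n) :
    ∃ k, IsChainLength n A k := by
  obtain ⟨N, hN⟩ : ∃ N, N = (A.1 1 1).toNat := ⟨_, rfl⟩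
  induction N using Nat.strong_induction_on generalizing A with
  | _ N ih =>
    by_cases hY : A ∈ setY n
    · exact ⟨0, by simp, hY⟩
    · obtain ⟨-, -, h3, h4, -⟩ := setS_iff.1 hA
      have hb : 0 < A.1 0 1 := lt_of_le_of_ne h4 fun h => hY ((mem_setY_iff hA).2 h.symm)
      have h11 : (opK A).1 1 1 = A.1 0 1 := by rw [opK_val]; rfl
      obtain ⟨k, hk1, hk2⟩ := ih _ (by omega) (opK_mem_setS hA hb) rfl
      refine ⟨k + 1, ?_, hk2⟩
      rintro (_ | j) hj
      · exact ⟨hA, hY⟩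
      · exact hk1 j (by omega)

theorem chainLength_spec {n : ℕ} (hn : 0 < n) (i : CosetSpace n) :
    IsChainLength n (matA n i) (chainLength n i) :=
  Classical.epsilon_spec (exists_isChainLength (matA_mem_setS hn i))

theorem iterate_opK_mem {n : ℕ} {x y : ℤ} {A : MatStar} (hA : A ∈ setS n)
    (hcl : InClass n x y A) {k : ℕ} (hk : IsChainLength n A k) {j : ℕ} (hj : j ≤ k) :
    opK^[j] A ∈ setS n ∧ InClass n x y (opK^[j] A) := by
  induction j with
  | zero => exact ⟨hA, hcl⟩
  | succ j ih =>
    obtain ⟨h1, h2⟩ := ih (by omega)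
    have hY := (hk.1 j hj).2
    rw [mem_setY_iff h1] at hY
    rw [Function.iterate_succ_apply']
    exact ⟨opK_mem_setS h1 (lt_of_le_of_ne (setS_iff.1 h1).2.2.2.1 (Ne.symm hY)),
      opK_inClass h2⟩

/-- The strict decrease makes the members of a chain pairwise distinct, so each has coefficient 1 in
ψ_i. -/
theorem iterate_opK_lt {n : ℕ} {A : MatStar} {k : ℕ} (hk : IsChainLength n A k) {i j : ℕ}
    (hij : i < j) (hj : j ≤ k) : (opK^[j] A).1 1 1 < (opK^[i] A).1 1 1 := by
  have hstep : ∀ l < k, (opK^[l + 1] A).1 1 1 < (opK^[l] A).1 1 1 := by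
    intro l hl
    have h11 : (opK (opK^[l] A)).1 1 1 = (opK^[l] A).1 0 1 := by rw [opK_val]; rfl
    rw [Function.iterate_succ_apply', h11]
    exact (setS_iff.1 (hk.1 l hl).1).2.2.1
  induction j, hij using Nat.le_induction with
  | base => exact hstep i hj
  | succ l _ ih => exact (hstep l hj).trans (ih (by omega))

/-- Every element of `S_n` in the class of `A_i` belongs to the chain of `A_i`. -/
theorem exists_iterate_opK_eq {n : ℕ} {x y : ℤ} (hxy : IsCoprime x y)
    {A : MatStar} (hA : A ∈ setS n) (hcl : InClass n x y A) (hA0 : A.1 1 0 = 0) {k : ℕ}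
    (hk : IsChainLength n A k) {B : MatStar} (hB : B ∈ setS n) (hBcl : InClass n x y B) :
    ∃ j ≤ k, opK^[j] A = B := by
  obtain ⟨N, hN⟩ : ∃ N, N = (B.1 0 0).toNat := ⟨_, rfl⟩
  induction N using Nat.strong_induction_on generalizing B with
  | _ N ih =>
    obtain ⟨h1, h2, -⟩ := setS_iff.1 hB
    rcases h2.eq_or_lt with h | h
    · exact ⟨0, by omega, eq_of_inClass_of_upper hxy hA hB hA0 h.symm hcl hBcl⟩
    · obtain ⟨C, hC, hCcl, hCb, hlt, rfl⟩ := exists_opK_eq hB hBcl h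
      obtain ⟨j, hj, rfl⟩ := ih _ (by omega) hC hCcl rfl
      refine ⟨j + 1, ?_, Function.iterate_succ_apply' ..⟩
      -- The predecessor cannot be the end of the chain: matrices in Y_n have upper right entry 0,
      -- whereas its entry is positive.
      rcases hj.eq_or_lt with rfl | hj
      · rw [(mem_setY_iff hC).1 hk.2] at hCb
        exact absurd hCb (lt_irrefl _)
      · exact hj

/-- Replaces the recursive description of ψ_i by a set that depends only on the lattice, on which
right multiplication by T and TM is easy to follow. -/
theorem psi_eq_sum {n : ℕ} (hn : 0 < n) (g : GL (Fin 2) ℤ) (F : Finset MatStar)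
    (hF : ∀ A, A ∈ F ↔ A ∈ setS n ∧ InClass n (g 1 0) (g 1 1 - g 1 0) A) :
    psi n (Quotient.mk _ g) = ∑ A ∈ F, single A := by
  classical
  have hk := chainLength_spec hn (Quotient.mk _ g)
  have hS := matA_mem_setS hn (Quotient.mk _ g)
  have hcl := matA_inClass hn g
  have hxy : IsCoprime (g 1 0) (g 1 1 - g 1 0) := by
    simpa [sub_eq_add_neg] using (isCoprime_bottom g).add_mul_left_right (-1)
  have hFim : F = (Finset.range (chainLength n (Quotient.mk _ g) + 1)).image
      (fun j => opK^[j] (matA n (Quotient.mk _ g))) := by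
    ext A
    rw [hF, Finset.mem_image]
    constructor
    · rintro ⟨h1, h2⟩
      obtain ⟨j, hj, h⟩ := exists_iterate_opK_eq hxy hS hcl (by rw [matA_val hn]; rfl) hk h1 h2
      exact ⟨j, Finset.mem_range.2 (by omega), h⟩
    · rintro ⟨j, hj, rfl⟩
      exact iterate_opK_mem hS hcl hk (by have := Finset.mem_range.1 hj; omega)
  rw [hFim, Finset.sum_image, psi]
  intro i hi j hj h
  simp only [Finset.coe_range, Set.mem_Iio] at hi hj
  dsimp only at h
  rcases lt_trichotomy i j with h' | h' | h'
  · have := iterate_opK_lt hk h' (by omega)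
    rw [h] at this
    exact absurd this (lt_irrefl _)
  · exact h'
  · have := iterate_opK_lt hk h' (by omega)
    rw [h] at this
    exact absurd this (lt_irrefl _)

/-! ### An identity between finite sums of matrices -/

/-- All six terms vanish if b < 0 or c < 0. Otherwise they depend only on how a and d compare with b
and c, and on how a + d compares with b + c; the finitely many cases are checked. -/
theorem transpose_indicator_identity (a b c d : ℤ) :
    ((if c < a ∧ 0 ≤ c ∧ b < d ∧ 0 ≤ b then 1 else 0) +
      (if b - d < a - c ∧ 0 ≤ b - d ∧ c < d ∧ 0 ≤ c then 1 else 0) +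
      (if b < a ∧ 0 ≤ b ∧ c - a < d - b ∧ 0 ≤ c - a then 1 else 0) : ℕ) =
    (if b < a ∧ 0 ≤ b ∧ c < d ∧ 0 ≤ c then 1 else 0) +
      (if c < a ∧ 0 ≤ c ∧ b - a < d - c ∧ 0 ≤ b - a then 1 else 0) +
      (if c - d < a - b ∧ 0 ≤ c - d ∧ b < d ∧ 0 ≤ b then 1 else 0) := by
  by_cases hb : 0 ≤ b
  · by_cases hc : 0 ≤ c
    · rcases lt_or_ge b a with h1 | h1 <;> rcases lt_or_ge c a with h2 | h2 <;>
      rcases lt_or_ge b d with h3 | h3 <;> rcases lt_or_ge c d with h4 | h4 <;>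
      rcases lt_or_ge (b - d) (a - c) with h5 | h5 <;>
      simp only [hb, hc, h1, h2, h3, h4, h5, sub_nonneg, true_and, and_true] <;> split_ifs <;> omega
    · split_ifs <;> omega
  · split_ifs <;> omega

theorem sum_add_sum_add_sum_eq {α N : Type*} [DecidableEq α] [AddCommMonoid N] (f : α → N)
    {F₁ F₂ F₃ G₁ G₂ G₃ : Finset α}
    (h : ∀ a, ((if a ∈ F₁ then 1 else 0) + (if a ∈ F₂ then 1 else 0) +
      (if a ∈ F₃ then 1 else 0) : ℕ) =
      (if a ∈ G₁ then 1 else 0) + (if a ∈ G₂ then 1 else 0) + (if a ∈ G₃ then 1 else 0)) :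
    ∑ a ∈ F₁, f a + ∑ a ∈ F₂, f a + ∑ a ∈ F₃, f a =
      ∑ a ∈ G₁, f a + ∑ a ∈ G₂, f a + ∑ a ∈ G₃, f a := by
  obtain ⟨U, hU⟩ : ∃ U, U = F₁ ∪ F₂ ∪ F₃ ∪ G₁ ∪ G₂ ∪ G₃ := ⟨_, rfl⟩
  have key : ∀ F ⊆ U, ∑ a ∈ F, f a = ∑ a ∈ U, (if a ∈ F then 1 else 0 : ℕ) • f a := by
    intro F hF
    simp only [ite_smul, one_smul, zero_smul]
    rw [← Finset.sum_filter, Finset.filter_mem_eq_inter, Finset.inter_eq_right.2 hF]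
  rw [key F₁, key F₂, key F₃, key G₁, key G₂, key G₃]
  · simp only [← Finset.sum_add_distrib, ← add_smul, h]
  all_goals
    rw [hU]
    intro a ha
    simp only [Finset.mem_union]
    tauto

/-! ### Multiplication by elements of `GL(2, ℤ)` -/

theorem ofGL_mul (g h : GL (Fin 2) ℤ) : ofGL (g * h) = ofGL g * ofGL h := rfl

theorem ofGL_one : ofGL 1 = 1 := rfl

/-- The permutation `A ↦ g A h` of the integral matrices with nonzero determinant. -/
noncomputable def mulEquiv (g h : GL (Fin 2) ℤ) : MatStar ≃ MatStar where
  toFun A := ofGL g * A * ofGL h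
  invFun A := ofGL g⁻¹ * A * ofGL h⁻¹
  left_inv A := by
    have h1 : ofGL g⁻¹ * ofGL g = 1 := by rw [← ofGL_mul, inv_mul_cancel, ofGL_one]
    have h2 : ofGL h * ofGL h⁻¹ = 1 := by rw [← ofGL_mul, mul_inv_cancel, ofGL_one]
    calc ofGL g⁻¹ * (ofGL g * A * ofGL h) * ofGL h⁻¹
        = (ofGL g⁻¹ * ofGL g) * A * (ofGL h * ofGL h⁻¹) := by simp only [mul_assoc]
      _ = A := by rw [h1, h2, one_mul, mul_one]
  right_inv A := by
    have h1 : ofGL g * ofGL g⁻¹ = 1 := by rw [← ofGL_mul, mul_inv_cancel, ofGL_one]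
    have h2 : ofGL h⁻¹ * ofGL h = 1 := by rw [← ofGL_mul, inv_mul_cancel, ofGL_one]
    calc ofGL g * (ofGL g⁻¹ * A * ofGL h⁻¹) * ofGL h
        = (ofGL g * ofGL g⁻¹) * A * (ofGL h⁻¹ * ofGL h) := by simp only [mul_assoc]
      _ = A := by rw [h1, h2, one_mul, mul_one]

theorem mulEquiv_symm_val (g h : GL (Fin 2) ℤ) (A : MatStar) :
    ((mulEquiv g h).symm A).1 = (g⁻¹).1 * A.1 * (h⁻¹).1 := rfl

theorem matT_inv_val : (matT⁻¹ : GL (Fin 2) ℤ).1 = !![1, -1; 0, 1] := rfl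

theorem matM_inv : (matM⁻¹ : GL (Fin 2) ℤ) = matM := by
  apply Units.ext
  rfl

theorem matM_val : (matM : GL (Fin 2) ℤ).1 = !![0, 1; 1, 0] := rfl

theorem matT_val : (matT : GL (Fin 2) ℤ).1 = !![1, 1; 0, 1] := rfl

/-- This and the next three formulas give preimages, since membership in the image of a finite set
under a permutation is tested on the preimage. -/
theorem symm_one_T (A : MatStar) : ((mulEquiv 1 matT).symm A).1 =
    !![A.1 0 0, A.1 0 1 - A.1 0 0; A.1 1 0, A.1 1 1 - A.1 1 0] := by
  rw [mulEquiv_symm_val, inv_one, matT_inv_val, Units.val_one, one_mul, Matrix.eta_fin_two A.1]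
  ext i j
  fin_cases i <;> fin_cases j <;> simp <;> ring

theorem symm_T_one (A : MatStar) : ((mulEquiv matT 1).symm A).1 =
    !![A.1 0 0 - A.1 1 0, A.1 0 1 - A.1 1 1; A.1 1 0, A.1 1 1] := by
  rw [mulEquiv_symm_val, inv_one, matT_inv_val, Units.val_one, mul_one, Matrix.eta_fin_two A.1]
  ext i j
  fin_cases i <;> fin_cases j <;> simp <;> ring

theorem symm_MTM_one (A : MatStar) : ((mulEquiv (matM * matT * matM) 1).symm A).1 =
    !![A.1 0 0, A.1 0 1; A.1 1 0 - A.1 0 0, A.1 1 1 - A.1 0 1] := by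
  rw [mulEquiv_symm_val, inv_one, mul_inv_rev, mul_inv_rev, matM_inv, Units.val_mul, Units.val_mul,
    matT_inv_val, matM_val, Units.val_one, mul_one, Matrix.eta_fin_two A.1]
  ext i j
  fin_cases i <;> fin_cases j <;> simp <;> ring

theorem symm_M_TM (A : MatStar) : ((mulEquiv matM (matT * matM)).symm A).1 =
    !![A.1 1 1, A.1 1 0 - A.1 1 1; A.1 0 1, A.1 0 0 - A.1 0 1] := by
  rw [mulEquiv_symm_val, mul_inv_rev, matM_inv, Units.val_mul,
    matT_inv_val, matM_val, Matrix.eta_fin_two A.1]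
  ext i j
  fin_cases i <;> fin_cases j <;> simp <;> ring

/-! ### Finiteness -/

theorem finite_box (n : ℕ) : {A : MatStar | ∀ i j, 0 ≤ A.1 i j ∧ A.1 i j ≤ n}.Finite := by
  refine ((Set.finite_Icc (fun _ _ => 0 : Fin 2 → Fin 2 → ℤ) fun _ _ => (n : ℤ)).preimage
    (f := fun A : MatStar => (A.1 : Fin 2 → Fin 2 → ℤ)) Subtype.val_injective.injOn).subset ?_
  exact fun A hA => ⟨fun i j => (hA i j).1, fun i j => (hA i j).2⟩

/-- From c ≤ a - 1 and b ≤ d - 1 follows bc ≤ (a - 1)(d - 1), that is n ≥ a + d - 1. -/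
theorem le_of_mem_cone {a b c d n : ℤ} (h1 : c < a) (h2 : 0 ≤ c) (h3 : b < d) (h4 : 0 ≤ b)
    (h : a * d - b * c = n) : a ≤ n ∧ b ≤ n ∧ c ≤ n ∧ d ≤ n := by
  have h5 : 0 ≤ (a - 1 - c) * d := mul_nonneg (by omega) (by omega)
  have h6 : 0 ≤ (a - 1) * (d - 1 - b) := mul_nonneg (by omega) (by omega)
  have h7 : 0 ≤ (d - b - 1) * c := mul_nonneg (by omega) (by omega)
  have h8 : 0 ≤ b * (a - 1 - c) := mul_nonneg (by omega) (by omega)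
  have h9 : n ≥ a + d - 1 := by nlinarith
  omega

theorem exists_finset_iff {n : ℕ} {P : MatStar → Prop}
    (hP : ∀ A, P A → ∀ i j, 0 ≤ A.1 i j ∧ A.1 i j ≤ n) :
    ∃ F : Finset MatStar, ∀ A, A ∈ F ↔ P A :=
  ⟨(((finite_box n).subset hP : Set.Finite {A | P A})).toFinset, fun A => by simp⟩

theorem exists_finset_setS (n : ℕ) (x y : ℤ) :
    ∃ F : Finset MatStar, ∀ A, A ∈ F ↔ A ∈ setS n ∧ InClass n x y A := by
  apply exists_finset_iff (n := n)
  rintro A ⟨hA, -⟩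
  obtain ⟨h1, h2, h3, h4, h5⟩ := setS_iff.1 hA
  obtain ⟨h6, h7, h8, h9⟩ := le_of_mem_cone h1 h2 h3 h4 h5
  intro i j
  fin_cases i <;> fin_cases j <;> dsimp only [Fin.zero_eta, Fin.mk_one] <;> constructor <;> omega

theorem exists_finset_transpose (n : ℕ) (x y : ℤ) :
    ∃ F : Finset MatStar, ∀ A, A ∈ F ↔ (A.1 0 1 < A.1 0 0 ∧ 0 ≤ A.1 0 1 ∧ A.1 1 0 < A.1 1 1 ∧
      0 ≤ A.1 1 0 ∧ A.1 0 0 * A.1 1 1 - A.1 0 1 * A.1 1 0 = n) ∧ InClass n x y A := by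
  apply exists_finset_iff (n := n)
  rintro A ⟨⟨h1, h2, h3, h4, h5⟩, -⟩
  obtain ⟨h6, h7, h8, h9⟩ := le_of_mem_cone (n := n) h1 h2 h3 h4 (by linarith)
  intro i j
  fin_cases i <;> fin_cases j <;> dsimp only [Fin.zero_eta, Fin.mk_one] <;> constructor <;> omega

/-! ### The nonnegative part of the right ideal -/

/-- The additive group generated by `(I - T - lam T M) C` for `C` with nonnegative entries. -/
noncomputable def nonnegIdeal (lam : ℤ) : AddSubgroup MatRing :=
  AddSubgroup.closure {R | ∃ C : MatStar, (∀ i j, 0 ≤ C.1 i j) ∧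
    R = single C - single (ofGL matT * C) - lam • single (ofGL (matT * matM) * C)}

theorem single_mul_single' (A B : MatStar) : single A * single B = single (A * B) := by
  simp [single]

theorem nonnegIdeal_le (lam : ℤ) : nonnegIdeal lam ≤ (lewisIdeal lam).toAddSubgroup := by
  rw [nonnegIdeal, AddSubgroup.closure_le]
  rintro _ ⟨C, -, rfl⟩
  change _ ∈ lewisIdeal lam
  have h := (lewisIdeal lam).smul_mem (MulOpposite.op (single C))
    (Submodule.subset_span (Set.mem_singleton _))
  simpa only [MulOpposite.smul_eq_mul_unop, MulOpposite.unop_op, sub_mul, smul_mul_assoc,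
    single_mul_single', ofGL_one, one_mul] using h

theorem gen_mem_nonnegIdeal (lam : ℤ) {C : MatStar} (hC : ∀ i j, 0 ≤ C.1 i j) :
    single C - single (ofGL matT * C) - lam • single (ofGL (matT * matM) * C) ∈
      nonnegIdeal lam :=
  AddSubgroup.subset_closure ⟨C, hC, rfl⟩

theorem matM_mul_nonneg {C : MatStar} (hC : ∀ i j, 0 ≤ C.1 i j) :
    ∀ i j, 0 ≤ (ofGL matM * C).1 i j := by
  have h : (ofGL matM * C).1 = matM.1 * C.1 := rfl
  rw [h, matM_val]
  intro i j
  fin_cases i <;> simp [Matrix.mul_apply, hC]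

theorem matM_mul_matM : (matM * matM : GL (Fin 2) ℤ) = 1 := by
  rw [← matM_inv, ← mul_inv_rev, inv_eq_one]
  apply Units.ext
  decide

/-- Take λ times the generator for C minus the generator for MC: passing from C to MC exchanges TC
and TMC, so these terms cancel because λ² = 1. -/
theorem swap_mem_nonnegIdeal {lam : ℤ} (hlam : lam = 1 ∨ lam = -1) {C : MatStar}
    (hC : ∀ i j, 0 ≤ C.1 i j) : lam • single C - single (ofGL matM * C) ∈ nonnegIdeal lam := by
  have h1 := gen_mem_nonnegIdeal lam hC
  have h2 := gen_mem_nonnegIdeal lam (matM_mul_nonneg hC)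
  have e1 : ofGL (matT * matM) * (ofGL matM * C) = ofGL matT * C := by
    rw [← mul_assoc, ← ofGL_mul, mul_assoc, matM_mul_matM, mul_one]
  have e2 : ofGL matT * (ofGL matM * C) = ofGL (matT * matM) * C := by
    rw [← mul_assoc, ← ofGL_mul]
  rw [e1, e2] at h2
  have h3 := sub_mem (zsmul_mem h1 lam) h2
  convert h3 using 1
  rcases hlam with rfl | rfl <;> module

/-- The generator for C plus the swap relation for TMC; this eliminates λ. -/
theorem additive_mem_nonnegIdeal {lam : ℤ} (hlam : lam = 1 ∨ lam = -1) {C : MatStar}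
    (hC : ∀ i j, 0 ≤ C.1 i j) :
    single C - single (mulEquiv matT 1 C) - single (mulEquiv (matM * matT * matM) 1 C) ∈
      nonnegIdeal lam := by
  have h1 := gen_mem_nonnegIdeal lam hC
  have hTM : ∀ i j, 0 ≤ (ofGL (matT * matM) * C).1 i j := by
    have h : (ofGL (matT * matM) * C).1 = matT.1 * matM.1 * C.1 := rfl
    rw [h, matM_val, matT_val]
    intro i j
    have h0 := hC 0 j
    have h1 := hC 1 j
    fin_cases i <;> simp [Matrix.mul_apply, Fin.sum_univ_two] <;> omega
  have h2 := swap_mem_nonnegIdeal hlam hTM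
  have e1 : ofGL matM * (ofGL (matT * matM) * C) = mulEquiv (matM * matT * matM) 1 C := by
    change _ = ofGL (matM * matT * matM) * C * ofGL 1
    rw [ofGL_one, mul_one, ← mul_assoc, ← ofGL_mul, mul_assoc matM]
  have e2 : ofGL matT * C = mulEquiv matT 1 C := by
    change _ = ofGL matT * C * ofGL 1
    rw [ofGL_one, mul_one]
  rw [e1] at h2
  rw [e2] at h1
  convert add_mem h1 h2 using 1
  abel

/-! ### The module equation -/

open Classical in
-- The required element is the sum of C - TC - MTM·C over W, minus the sum of λA·TM - M·A·TM over
-- F₃; the matrix identity accounts for everything else.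
theorem sum_sub_mem_nonnegIdeal {n : ℕ} {lam : ℤ} (hlam : lam = 1 ∨ lam = -1) {x y : ℤ}
    {F₁ F₂ F₃ : Finset MatStar} (h₁ : ∀ A, A ∈ F₁ ↔ A ∈ setS n ∧ InClass n x y A)
    (h₂ : ∀ A, A ∈ F₂ ↔ A ∈ setS n ∧ InClass n x (y - x) A)
    (h₃ : ∀ A, A ∈ F₃ ↔ A ∈ setS n ∧ InClass n y (x - y) A) :
    ∑ A ∈ F₁, single A - (∑ A ∈ F₂, single A) * single (ofGL matT)
      - lam • ((∑ A ∈ F₃, single A) * single (ofGL (matT * matM))) ∈ nonnegIdeal lam := by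
  obtain ⟨W, hW⟩ := exists_finset_transpose n x y
  have key := sum_add_sum_add_sum_eq single (F₁ := F₁)
    (F₂ := W.map (mulEquiv matT 1).toEmbedding)
    (F₃ := W.map (mulEquiv (matM * matT * matM) 1).toEmbedding) (G₁ := W)
    (G₂ := F₂.map (mulEquiv 1 matT).toEmbedding)
    (G₃ := F₃.map (mulEquiv matM (matT * matM)).toEmbedding) (by
      intro A
      simp only [Finset.mem_map_equiv, h₁, h₂, h₃, hW, setS_iff, InClass, symm_one_T, symm_T_one,
        symm_MTM_one, symm_M_TM, Matrix.of_apply, Matrix.cons_val_zero, Matrix.cons_val_one,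
        Matrix.cons_val', Matrix.cons_val_fin_one]
      generalize A.1 0 0 = a
      generalize A.1 0 1 = b
      generalize A.1 1 0 = c
      generalize A.1 1 1 = d
      -- Determinant and lattice conditions are the same for all six sets. Where they fail all
      -- indicators are 0; where they hold only the inequalities remain.
      by_cases hdc : a * d - b * c = n ∧ (n : ℤ) ∣ a * y - b * x ∧ (n : ℤ) ∣ c * y - d * x
      · obtain ⟨hdet, hc1, hc2⟩ := hdc
        have e1 : (a - c) * d - (b - d) * c = n := by linarith
        have e2 : a * (d - b) - b * (c - a) = n := by linarith
        have e3 : a * (d - c) - (b - a) * c = n := by linarith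
        have e4 : d * (a - b) - (c - d) * b = n := by linarith
        have f1 : (n : ℤ) ∣ (a - c) * y - (b - d) * x :=
          (dvd_sub hc1 hc2).trans (dvd_of_eq (by ring))
        have f2 : (n : ℤ) ∣ (c - a) * y - (d - b) * x :=
          (dvd_sub hc2 hc1).trans (dvd_of_eq (by ring))
        have f3 : (n : ℤ) ∣ a * (y - x) - (b - a) * x := hc1.trans (dvd_of_eq (by ring))
        have f4 : (n : ℤ) ∣ c * (y - x) - (d - c) * x := hc2.trans (dvd_of_eq (by ring))
        have f5 : (n : ℤ) ∣ d * (x - y) - (c - d) * y := (dvd_neg.2 hc2).trans (dvd_of_eq (by ring))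
        have f6 : (n : ℤ) ∣ b * (x - y) - (a - b) * y := (dvd_neg.2 hc1).trans (dvd_of_eq (by ring))
        simp only [hdet, hc1, hc2, e1, e2, e3, e4, f1, f2, f3, f4, f5, f6, and_true]
        have := transpose_indicator_identity a b c d
        convert this using 3
        constructor <;> rintro ⟨p1, p2, p3, p4⟩ <;> exact ⟨p3, p4, p1, p2⟩
      · rw [if_neg, if_neg, if_neg, if_neg, if_neg, if_neg]
        all_goals
          rintro ⟨⟨-, -, -, -, h5⟩, h6, h7⟩
          refine hdc ⟨by linarith, ?_⟩
        · exact ⟨(dvd_neg.2 h7).trans (dvd_of_eq (by ring)),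
            (dvd_neg.2 h6).trans (dvd_of_eq (by ring))⟩
        · exact ⟨h6.trans (dvd_of_eq (by ring)), h7.trans (dvd_of_eq (by ring))⟩
        · exact ⟨h6, h7⟩
        · exact ⟨h6, (dvd_add h6 h7).trans (dvd_of_eq (by ring))⟩
        · exact ⟨(dvd_add h6 h7).trans (dvd_of_eq (by ring)), h7⟩
        · exact ⟨h6, h7⟩)
  have hsum : ∑ C ∈ W, (single C - single (mulEquiv matT 1 C) -
      single (mulEquiv (matM * matT * matM) 1 C)) ∈ nonnegIdeal lam := by
    refine sum_mem fun C hC => additive_mem_nonnegIdeal hlam ?_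
    obtain ⟨⟨p1, p2, p3, p4, -⟩, -⟩ := (hW C).1 hC
    intro i j
    fin_cases i <;> fin_cases j <;> dsimp only [Fin.zero_eta, Fin.mk_one] <;> omega
  have hswap : ∑ A ∈ F₃, (lam • single (A * ofGL (matT * matM)) -
      single (mulEquiv matM (matT * matM) A)) ∈ nonnegIdeal lam := by
    refine sum_mem fun A hA => ?_
    obtain ⟨p1, p2, p3, p4, -⟩ := setS_iff.1 ((h₃ A).1 hA).1
    have e : mulEquiv matM (matT * matM) A = ofGL matM * (A * ofGL (matT * matM)) :=
      mul_assoc _ _ _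
    rw [e]
    apply swap_mem_nonnegIdeal hlam
    have h : (A * ofGL (matT * matM)).1 = A.1 * (matT.1 * matM.1) := rfl
    rw [h, matM_val, matT_val]
    intro i j
    fin_cases i <;> fin_cases j <;> simp [Matrix.mul_apply, Fin.sum_univ_two] <;> omega
  have hT : ∀ A : MatStar, A * ofGL matT = mulEquiv 1 matT A := fun A => by
    change _ = ofGL 1 * A * ofGL matT
    rw [ofGL_one, one_mul]
  simp only [Finset.sum_map, Equiv.coe_toEmbedding] at key
  simp only [Finset.sum_sub_distrib] at hsum hswap
  simp only [Finset.sum_mul, single_mul_single', Finset.smul_sum, hT]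
  convert sub_mem hsum hswap using 1
  rw [← sub_eq_zero] at key ⊢
  rw [← key]
  abel

theorem psi_sub_mem_nonnegIdeal {n : ℕ} (hn : 0 < n) {lam : ℤ} (hlam : lam = 1 ∨ lam = -1)
    (i : CosetSpace n) :
    psi n i - psi n (i.act matT⁻¹) * single (ofGL matT)
      - lam • (psi n (i.act (matT⁻¹ * matM)) * single (ofGL (matT * matM))) ∈
      nonnegIdeal lam := by
  induction i using Quotient.inductionOn with | _ g
  obtain ⟨F₁, h₁⟩ := exists_finset_setS n (g 1 0) (g 1 1 - g 1 0)
  obtain ⟨F₂, h₂⟩ := exists_finset_setS n (g 1 0) (g 1 1 - g 1 0 - g 1 0)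
  obtain ⟨F₃, h₃⟩ := exists_finset_setS n (g 1 1 - g 1 0) (g 1 0 - (g 1 1 - g 1 0))
  have a1 : CosetSpace.act (n := n) (Quotient.mk _ g) matT⁻¹ = Quotient.mk _ (g * matT⁻¹) := rfl
  have a2 : CosetSpace.act (n := n) (Quotient.mk _ g) (matT⁻¹ * matM) =
    Quotient.mk _ (g * (matT⁻¹ * matM)) := rfl
  have b : (g * matT⁻¹).1 = !![g 0 0, g 0 1 - g 0 0; g 1 0, g 1 1 - g 1 0] := by
    rw [Units.val_mul, matT_inv_val, Matrix.eta_fin_two g.1]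
    ext i j
    fin_cases i <;> fin_cases j <;> simp <;> ring
  have c : (g * (matT⁻¹ * matM)).1 = !![g 0 1 - g 0 0, g 0 0; g 1 1 - g 1 0, g 1 0] := by
    rw [← mul_assoc, Units.val_mul, b, matM_val]
    simp
  rw [a1, a2, psi_eq_sum hn g F₁ h₁, psi_eq_sum hn _ F₂ (by rw [b]; exact h₂),
    psi_eq_sum hn _ F₃ (by rw [c]; exact h₃)]
  exact sum_sub_mem_nonnegIdeal hlam h₁ h₂ h₃

/-! ### Principal powers and Möbius maps on the slit plane -/

open Complex in
-- Imaginary parts of opposite sign give arguments of opposite sign, so their sum stays in (-π, π]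
-- and the logarithm is additive.
theorem mul_cpow_of_im_mul_im_nonpos {z w : ℂ} (hz : z ∈ slitPlane) (hw : w ∈ slitPlane)
    (h : z.im * w.im ≤ 0) (e : ℂ) : (z * w) ^ e = z ^ e * w ^ e := by
  have hz0 := slitPlane_ne_zero hz
  have hw0 := slitPlane_ne_zero hw
  have hlog : log (z * w) = log z + log w := by
    rw [log_mul_eq_add_log_iff hz0 hw0]
    have h1 := arg_le_pi z
    have h2 := arg_le_pi w
    have h3 := neg_pi_lt_arg z
    have h4 := neg_pi_lt_arg w
    rcases lt_trichotomy z.im 0 with hi | hi | hi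
    · have := arg_neg_iff.2 hi
      have := arg_nonneg_iff.2 (show 0 ≤ w.im by nlinarith)
      constructor <;> linarith
    · have hre : 0 ≤ z.re := (hz.resolve_right (by simp [hi])).le
      rw [arg_eq_zero_iff.2 ⟨hre, hi⟩, zero_add]
      exact ⟨h4, h2⟩
    · have := arg_nonneg_iff.2 hi.le
      rcases lt_or_ge w.im 0 with hwi | hwi
      · have := arg_neg_iff.2 hwi
        constructor <;> linarith
      · have hwi : w.im = 0 := by nlinarith
        have hre : 0 ≤ w.re := (hw.resolve_right (by simp [hwi])).le
        rw [arg_eq_zero_iff.2 ⟨hre, hwi⟩, add_zero]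
        exact ⟨h3, h1⟩
  rw [cpow_def_of_ne_zero (mul_ne_zero hz0 hw0), cpow_def_of_ne_zero hz0, cpow_def_of_ne_zero hw0,
    hlog, add_mul, exp_add]

theorem inv_mem_slitPlane {z : ℂ} (hz : z ∈ Complex.slitPlane) : z⁻¹ ∈ Complex.slitPlane := by
  have h := Complex.normSq_pos.2 (Complex.slitPlane_ne_zero hz)
  rw [Complex.mem_slitPlane_iff] at hz ⊢
  rw [Complex.inv_re, Complex.inv_im]
  rcases hz with hz | hz
  · left
    positivity
  · right
    exact div_ne_zero (neg_ne_zero.2 hz) h.ne'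

theorem linear_mem_slitPlane {p q : ℝ} (hp : 0 ≤ p) (hq : 0 ≤ q) (h : p ≠ 0 ∨ q ≠ 0) {z : ℂ}
    (hz : z ∈ Complex.slitPlane) : (p : ℂ) * z + q ∈ Complex.slitPlane := by
  rw [Complex.mem_slitPlane_iff] at hz ⊢
  simp only [Complex.add_re, Complex.mul_re, Complex.ofReal_re, Complex.ofReal_im, zero_mul,
    sub_zero, Complex.add_im, Complex.mul_im, add_zero]
  rcases hp.eq_or_lt with rfl | hp
  · left
    have : 0 < q := lt_of_le_of_ne hq (Ne.symm (h.resolve_left (by simp)))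
    simpa using this
  · rcases hz with hz | hz
    · left
      positivity
    · right
      positivity

variable {C : MatStar}

theorem den_mem_slitPlane (hC : ∀ i j, 0 ≤ C.1 i j) (k : Fin 2) {z : ℂ}
    (hz : z ∈ Complex.slitPlane) :
    (C.1 k 0 : ℂ) * z + (C.1 k 1 : ℂ) ∈ Complex.slitPlane := by
  have h := linear_mem_slitPlane (p := C.1 k 0) (q := C.1 k 1) (by exact_mod_cast hC k 0)
    (by exact_mod_cast hC k 1) (by
      by_contra! hcon
      obtain ⟨h0, h1⟩ := hcon
      apply C.2
      have h0 : C.1 k 0 = 0 := by exact_mod_cast h0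
      have h1 : C.1 k 1 = 0 := by exact_mod_cast h1
      rw [Matrix.det_fin_two]
      fin_cases k <;> simp_all) hz
  simpa using h

theorem im_div_eq (C : MatStar) (z : ℂ) :
    (((C.1 0 0 : ℂ) * z + (C.1 0 1 : ℂ)) / ((C.1 1 0 : ℂ) * z + (C.1 1 1 : ℂ))).im =
      C.1.det * z.im / Complex.normSq ((C.1 1 0 : ℂ) * z + (C.1 1 1 : ℂ)) := by
  rw [Complex.div_im, ← sub_div]
  congr 1
  rw [Matrix.det_fin_two]
  simp
  ring

theorem moebius_mem_slitPlane (hC : ∀ i j, 0 ≤ C.1 i j) {z : ℂ} (hz : z ∈ Complex.slitPlane) :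
    ((C.1 0 0 : ℂ) * z + (C.1 0 1 : ℂ)) / ((C.1 1 0 : ℂ) * z + (C.1 1 1 : ℂ)) ∈
      Complex.slitPlane := by
  have hn := den_mem_slitPlane hC 0 hz
  have hd := den_mem_slitPlane hC 1 hz
  by_cases him : z.im = 0
  · have hre : 0 < z.re := hz.resolve_right (by simp [him])
    obtain ⟨t, rfl⟩ : ∃ t : ℝ, z = t := ⟨z.re, Complex.ext rfl (by simp [him])⟩
    rw [Complex.ofReal_re] at hre
    have hcast : ∀ k, (C.1 k 0 : ℂ) * t + (C.1 k 1 : ℂ) = ((C.1 k 0 * t + C.1 k 1 : ℝ) : ℂ) := by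
      intro k
      push_cast
      ring
    rw [hcast, Complex.ofReal_mem_slitPlane] at hn hd
    rw [hcast, hcast, ← Complex.ofReal_div, Complex.ofReal_mem_slitPlane]
    positivity
  · right
    rw [im_div_eq]
    have h1 := Complex.normSq_pos.2 (Complex.slitPlane_ne_zero hd)
    have h2 : (C.1.det : ℝ) ≠ 0 := by exact_mod_cast C.2
    positivity

/-- Let w = N / D; Im w has the sign of det C · Im z. For det C ≤ 0 the factors D and w have
imaginary parts of opposite sign. For det C ≥ 0 this fails, but N and w⁻¹ do, so D = N·w⁻¹ is split
instead. -/
theorem cpow_num_eq (hC : ∀ i j, 0 ≤ C.1 i j) {z : ℂ} (hz : z ∈ Complex.slitPlane) (e : ℂ) :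
    ((C.1 1 0 : ℂ) * z + (C.1 1 1 : ℂ)) ^ e *
      (((C.1 0 0 : ℂ) * z + (C.1 0 1 : ℂ)) / ((C.1 1 0 : ℂ) * z + (C.1 1 1 : ℂ))) ^ e =
      ((C.1 0 0 : ℂ) * z + (C.1 0 1 : ℂ)) ^ e := by
  have hn := den_mem_slitPlane hC 0 hz
  have hd := den_mem_slitPlane hC 1 hz
  have hw := moebius_mem_slitPlane hC hz
  have hpos := Complex.normSq_pos.2 (Complex.slitPlane_ne_zero hd)
  have him := im_div_eq C z
  have hd0 := Complex.slitPlane_ne_zero hd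
  have hn0 := Complex.slitPlane_ne_zero hn
  have hwmul := div_mul_cancel₀ ((C.1 0 0 : ℂ) * z + (C.1 0 1 : ℂ)) hd0
  have hc : (0 : ℝ) ≤ C.1 1 0 := by exact_mod_cast hC 1 0
  have ha : (0 : ℝ) ≤ C.1 0 0 := by exact_mod_cast hC 0 0
  have hdim : ((C.1 1 0 : ℂ) * z + (C.1 1 1 : ℂ)).im = C.1 1 0 * z.im := by simp
  have hnim : ((C.1 0 0 : ℂ) * z + (C.1 0 1 : ℂ)).im = C.1 0 0 * z.im := by simp
  generalize (C.1 0 0 : ℂ) * z + (C.1 0 1 : ℂ) = N at *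
  generalize (C.1 1 0 : ℂ) * z + (C.1 1 1 : ℂ) = D at *
  generalize N / D = w at *
  rcases le_total C.1.det 0 with hdet | hdet
  · have hdet' : (C.1.det : ℝ) ≤ 0 := by exact_mod_cast hdet
    rw [← hwmul, mul_comm w D, mul_cpow_of_im_mul_im_nonpos hd hw]
    rw [hdim, him]
    have : (C.1 1 0 : ℝ) * z.im * (C.1.det * z.im / Complex.normSq D) =
      C.1.det * ((C.1 1 0 : ℝ) * (z.im * z.im) / Complex.normSq D) := by ring
    rw [this]
    exact mul_nonpos_of_nonpos_of_nonneg hdet'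
      (div_nonneg (mul_nonneg hc (mul_self_nonneg _)) hpos.le)
  · have hdet' : (0 : ℝ) ≤ C.1.det := by exact_mod_cast hdet
    have hw0 := Complex.slitPlane_ne_zero hw
    have hD : D = N * w⁻¹ := by
      rw [← hwmul]
      field_simp
    have hwinv : w⁻¹ ∈ Complex.slitPlane := inv_mem_slitPlane hw
    have h1 : D ^ e = N ^ e * (w⁻¹) ^ e := by
      conv_lhs => rw [hD]
      apply mul_cpow_of_im_mul_im_nonpos hn hwinv
      rw [Complex.inv_im, hnim, him]
      have : (C.1 0 0 : ℝ) * z.im * (-(C.1.det * z.im / Complex.normSq D) / Complex.normSq w) =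
        -(C.1.det * (C.1 0 0 * (z.im * z.im)) / Complex.normSq D / Complex.normSq w) := by ring
      rw [this, neg_nonpos]
      have := Complex.normSq_nonneg w
      have := mul_self_nonneg z.im
      positivity
    rw [h1, Complex.inv_cpow _ _ (Complex.mem_slitPlane_iff_arg.1 hw).1, mul_assoc,
      inv_mul_cancel₀, mul_one]
    rw [Complex.cpow_def_of_ne_zero hw0]
    exact Complex.exp_ne_zero _

/-! ### The slash operation on formal combinations -/

/-- `R ↦ (φ |_s R)(z)` as a homomorphism of additive groups. -/
noncomputable def slashHom (s : ℂ) (φ : ℂ → ℂ) (z : ℂ) : MatRing →+ ℂ where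
  toFun R := slashRing s φ R z
  map_zero' := by simp [slashRing]
  map_add' R R' := by
    rw [slashRing, MonoidAlgebra.coeff_add, Finsupp.sum_add_index']
    · rfl
    · simp
    · intro A m m'
      push_cast
      ring

theorem slashHom_apply (s : ℂ) (φ : ℂ → ℂ) (z : ℂ) (R : MatRing) :
    slashHom s φ z R = slashRing s φ R z := rfl

theorem slashHom_single (s : ℂ) (φ : ℂ → ℂ) (z : ℂ) (A : MatStar) :
    slashHom s φ z (single A) = slash s φ A z := by
  rw [slashHom_apply, slashRing, single, MonoidAlgebra.coeff_single,
    Finsupp.sum_single_index] <;> simp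

theorem differentiableOn_slash (s : ℂ) {φ : ℂ → ℂ} (hφ : DifferentiableOn ℂ φ Complex.slitPlane)
    {A : MatStar} (hA : ∀ i j, 0 ≤ A.1 i j) :
    DifferentiableOn ℂ (slash s φ A) Complex.slitPlane := by
  have hlin : ∀ k, DifferentiableOn ℂ (fun z : ℂ => (A.1 k 0 : ℂ) * z + (A.1 k 1 : ℂ))
      Complex.slitPlane := fun k => by fun_prop
  have hden : ∀ z ∈ Complex.slitPlane, (A.1 1 0 : ℂ) * z + (A.1 1 1 : ℂ) ∈ Complex.slitPlane :=
    fun z hz => den_mem_slitPlane hA 1 hz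
  unfold slash
  refine DifferentiableOn.mul (DifferentiableOn.mul (differentiableOn_const _) ?_) ?_
  · exact (hlin 1).cpow_const hden
  · exact hφ.comp ((hlin 0).div (hlin 1) fun z hz => Complex.slitPlane_ne_zero (hden z hz))
      fun z hz => moebius_mem_slitPlane hA hz

/-- This is the scalar equation at the point w = Cz, multiplied by the automorphy factor of C;
`cpow_num_eq` combines the factor w^(-2s) with it into the one of TMC. -/
theorem slash_gen_eq_zero {lam : ℤ} {s : ℂ} {φ : ℂ → ℂ} (hφ : IsScalarSolution lam s φ)
    {C : MatStar} (hC : ∀ i j, 0 ≤ C.1 i j) {z : ℂ} (hz : z ∈ Complex.slitPlane) :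
    slash s φ C z - slash s φ (ofGL matT * C) z
      - (lam : ℂ) * slash s φ (ofGL (matT * matM) * C) z = 0 := by
  have e1 : (ofGL matT * C).1 =
      !![C.1 0 0 + C.1 1 0, C.1 0 1 + C.1 1 1; C.1 1 0, C.1 1 1] := by
    have h : (ofGL matT * C).1 = matT.1 * C.1 := rfl
    rw [h, matT_val, Matrix.eta_fin_two C.1]
    simp
  have e2 : (ofGL (matT * matM) * C).1 =
      !![C.1 0 0 + C.1 1 0, C.1 0 1 + C.1 1 1; C.1 0 0, C.1 0 1] := by
    have h : (ofGL (matT * matM) * C).1 = matT.1 * matM.1 * C.1 := rfl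
    rw [h, matT_val, matM_val, Matrix.eta_fin_two C.1]
    simp
  have d1 : |(ofGL matT * C).1.det| = |C.1.det| := by
    rw [e1, Matrix.det_fin_two_of, Matrix.det_fin_two]
    congr 1
    ring
  have d2 : |(ofGL (matT * matM) * C).1.det| = |C.1.det| := by
    rw [e2, Matrix.det_fin_two_of, Matrix.det_fin_two, ← abs_neg]
    congr 1
    ring
  have hw := moebius_mem_slitPlane hC hz
  have hn0 := Complex.slitPlane_ne_zero (den_mem_slitPlane hC 0 hz)
  have hd0 := Complex.slitPlane_ne_zero (den_mem_slitPlane hC 1 hz)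
  have hφw := hφ.2 _ hw
  have hpow := cpow_num_eq hC hz (-2 * s)
  unfold slash
  rw [d1, d2, e1, e2]
  simp only [Matrix.of_apply, Matrix.cons_val_zero, Matrix.cons_val_one, Matrix.cons_val',
    Matrix.cons_val_fin_one]
  push_cast
  have q1 : (((C.1 0 0 : ℂ) + C.1 1 0) * z + (C.1 0 1 + C.1 1 1)) /
      ((C.1 1 0 : ℂ) * z + (C.1 1 1 : ℂ)) =
      ((C.1 0 0 : ℂ) * z + (C.1 0 1 : ℂ)) / ((C.1 1 0 : ℂ) * z + (C.1 1 1 : ℂ)) + 1 := by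
    rw [div_add_one hd0]
    ring
  have q2 : (((C.1 0 0 : ℂ) + C.1 1 0) * z + (C.1 0 1 + C.1 1 1)) /
      ((C.1 0 0 : ℂ) * z + (C.1 0 1 : ℂ)) =
      1 + 1 / (((C.1 0 0 : ℂ) * z + (C.1 0 1 : ℂ)) / ((C.1 1 0 : ℂ) * z + (C.1 1 1 : ℂ))) := by
    rw [one_div_div, one_add_div hn0]
    ring
  rw [q1, q2, ← hpow, hφw]
  ring

theorem slashHom_eq_zero_of_mem {lam : ℤ} {s : ℂ} {φ : ℂ → ℂ} (hφ : IsScalarSolution lam s φ)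
    {R : MatRing} (hR : R ∈ nonnegIdeal lam) {z : ℂ} (hz : z ∈ Complex.slitPlane) :
    slashHom s φ z R = 0 := by
  have h : nonnegIdeal lam ≤ (slashHom s φ z).ker := by
    rw [nonnegIdeal, AddSubgroup.closure_le]
    rintro _ ⟨C, hC, rfl⟩
    change slashHom s φ z _ = 0
    rw [map_sub, map_sub, map_zsmul, slashHom_single, slashHom_single, slashHom_single,
      zsmul_eq_mul]
    exact slash_gen_eq_zero hφ hC hz
  exact h hR

theorem slash_mul_T (s : ℂ) (φ : ℂ → ℂ) (A : MatStar) (z : ℂ) :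
    slash s φ (A * ofGL matT) z = slash s φ A (z + 1) := by
  have e : (A * ofGL matT).1 =
      !![A.1 0 0, A.1 0 0 + A.1 0 1; A.1 1 0, A.1 1 0 + A.1 1 1] := by
    have h : (A * ofGL matT).1 = A.1 * matT.1 := rfl
    rw [h, matT_val, Matrix.eta_fin_two A.1]
    simp
  have d : (A * ofGL matT).1.det = A.1.det := by
    rw [e, Matrix.det_fin_two_of, Matrix.det_fin_two]
    ring
  unfold slash
  rw [d, e]
  simp only [Matrix.of_apply, Matrix.cons_val_zero, Matrix.cons_val_one, Matrix.cons_val',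
    Matrix.cons_val_fin_one]
  push_cast
  simp only [mul_add, mul_one, add_assoc]

theorem one_add_one_div_mem_slitPlane {z : ℂ} (hz : z ∈ Complex.slitPlane) :
    1 + 1 / z ∈ Complex.slitPlane := by
  have h := linear_mem_slitPlane zero_le_one zero_le_one (by simp) (inv_mem_slitPlane hz)
  simpa [add_comm] using h

theorem slash_mul_TM (s : ℂ) (φ : ℂ → ℂ) {A : MatStar} (hA : ∀ i j, 0 ≤ A.1 i j) {z : ℂ}
    (hz : z ∈ Complex.slitPlane) :
    slash s φ (A * ofGL (matT * matM)) z = z ^ (-2 * s) * slash s φ A (1 + 1 / z) := by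
  have e : (A * ofGL (matT * matM)).1 =
      !![A.1 0 0 + A.1 0 1, A.1 0 0; A.1 1 0 + A.1 1 1, A.1 1 0] := by
    have h : (A * ofGL (matT * matM)).1 = A.1 * (matT.1 * matM.1) := rfl
    rw [h, matT_val, matM_val, Matrix.eta_fin_two A.1]
    simp
  have d : |(A * ofGL (matT * matM)).1.det| = |A.1.det| := by
    rw [e, Matrix.det_fin_two_of, Matrix.det_fin_two, ← abs_neg]
    congr 1
    ring
  have hz0 := Complex.slitPlane_ne_zero hz
  have hden := den_mem_slitPlane hA 1 (one_add_one_div_mem_slitPlane hz)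
  have hmul : ∀ k, ((A.1 k 0 : ℂ) + A.1 k 1) * z + A.1 k 0 =
      z * ((A.1 k 0 : ℂ) * (1 + 1 / z) + A.1 k 1) := by
    intro k
    field_simp
    ring
  -- Im(1/z) has the opposite sign to Im z and the coefficient of 1/z is nonnegative.
  have hpow := mul_cpow_of_im_mul_im_nonpos hz hden (by
    have hc : (0 : ℝ) ≤ A.1 1 0 := by exact_mod_cast hA 1 0
    have him : ((A.1 1 0 : ℂ) * (1 + 1 / z) + A.1 1 1).im =
        A.1 1 0 * (-z.im / Complex.normSq z) := by
      simp [Complex.inv_im]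
    rw [him]
    have : z.im * ((A.1 1 0 : ℝ) * (-z.im / Complex.normSq z)) =
        -((A.1 1 0 : ℝ) * (z.im * z.im) / Complex.normSq z) := by ring
    rw [this, neg_nonpos]
    exact div_nonneg (mul_nonneg hc (mul_self_nonneg _)) (Complex.normSq_nonneg _)) (-2 * s)
  unfold slash
  rw [d, e]
  simp only [Matrix.of_apply, Matrix.cons_val_zero, Matrix.cons_val_one, Matrix.cons_val',
    Matrix.cons_val_fin_one]
  push_cast
  rw [hmul, hmul, hpow, mul_div_mul_left _ _ hz0]
  ring

/-! ### The vector Lewis equation -/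

theorem nonneg_of_mem_setS {n : ℕ} {A : MatStar} (hA : A ∈ setS n) : ∀ i j, 0 ≤ A.1 i j := by
  obtain ⟨h1, h2, h3, h4, -⟩ := setS_iff.1 hA
  intro i j
  fin_cases i <;> fin_cases j <;> dsimp only [Fin.zero_eta, Fin.mk_one] <;> omega

theorem iterate_opK_matA_mem_setS {n : ℕ} (hn : 0 < n) (i : CosetSpace n) {j : ℕ}
    (hj : j ∈ Finset.range (chainLength n i + 1)) : opK^[j] (matA n i) ∈ setS n := by
  induction i using Quotient.inductionOn with | _ g
  exact (iterate_opK_mem (matA_mem_setS hn _) (matA_inClass hn g) (chainLength_spec hn _)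
    (Nat.lt_succ_iff.1 (Finset.mem_range.1 hj))).1

theorem mem_setS_of_mem_support_psi {n : ℕ} (hn : 0 < n) {i : CosetSpace n} {A : MatStar}
    (hA : A ∈ (psi n i).coeff.support) : A ∈ setS n := by
  classical
  rw [psi, MonoidAlgebra.coeff_sum] at hA
  obtain ⟨j, hj, h⟩ := Finset.mem_biUnion.1 (Finsupp.support_finsetSum hA)
  rw [single, MonoidAlgebra.coeff_single] at h
  rw [Finset.mem_singleton.1 (Finsupp.support_single_subset h)]
  exact iterate_opK_matA_mem_setS hn i hj

theorem slashRing_psi (n : ℕ) (i : CosetSpace n) (s : ℂ) (φ : ℂ → ℂ) (z : ℂ) :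
    slashRing s φ (psi n i) z =
      ∑ j ∈ Finset.range (chainLength n i + 1), slash s φ (opK^[j] (matA n i)) z := by
  rw [← slashHom_apply, psi, map_sum]
  exact Finset.sum_congr rfl fun j _ => slashHom_single ..

theorem slashDefined_of_mem_setS {n : ℕ} {lam : ℤ} {s : ℂ} {φ : ℂ → ℂ}
    (hφ : IsScalarSolution lam s φ) {A : MatStar} (hA : A ∈ setS n) : SlashDefined φ A := by
  obtain ⟨h1, h2, h3, h4, -⟩ := setS_iff.1 hA
  -- The branching point 0 serves for all matrices, since a > 0 on S_n.
  refine ⟨?_, 0, hφ.1, ?_⟩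
  · rcases h2.eq_or_lt with h | h
    · exact Or.inr ⟨h.symm, by omega, by omega⟩
    · exact Or.inl h
  · rw [mul_zero, sub_zero]
    exact_mod_cast lt_of_le_of_lt h2 h1

theorem isVectorSolution_slashRing_psi {n : ℕ} (hn : 0 < n) {lam : ℤ} (hlam : lam = 1 ∨ lam = -1)
    {s : ℂ} {φ : ℂ → ℂ} (hφ : IsScalarSolution lam s φ) :
    IsVectorSolution n lam s fun i => slashRing s φ (psi n i) := by
  intro i
  constructor
  · have h : slashRing s φ (psi n i) = fun z => ∑ j ∈ Finset.range (chainLength n i + 1),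
        slash s φ (opK^[j] (matA n i)) z := funext fun z => slashRing_psi n i s φ z
    dsimp only
    rw [h]
    exact DifferentiableOn.fun_sum fun j hj =>
      differentiableOn_slash s hφ.1 (nonneg_of_mem_setS (iterate_opK_matA_mem_setS hn i hj))
  · intro z hz
    have h := slashHom_eq_zero_of_mem hφ (psi_sub_mem_nonnegIdeal hn hlam i) hz
    rw [map_sub, map_sub, map_zsmul, zsmul_eq_mul] at h
    have h1 : slashHom s φ z (psi n (i.act matT⁻¹) * single (ofGL matT)) =
        slashRing s φ (psi n (i.act matT⁻¹)) (z + 1) := by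
      rw [slashRing_psi, psi, Finset.sum_mul, map_sum]
      refine Finset.sum_congr rfl fun j _ => ?_
      rw [single_mul_single', slashHom_single, slash_mul_T]
    have h2 : slashHom s φ z (psi n (i.act (matT⁻¹ * matM)) * single (ofGL (matT * matM))) =
        z ^ (-2 * s) * slashRing s φ (psi n (i.act (matT⁻¹ * matM))) (1 + 1 / z) := by
      rw [slashRing_psi, psi, Finset.sum_mul, map_sum, Finset.mul_sum]
      refine Finset.sum_congr rfl fun j hj => ?_
      rw [single_mul_single', slashHom_single,
        slash_mul_TM s φ (nonneg_of_mem_setS (iterate_opK_matA_mem_setS hn _ hj)) hz]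
    rw [h1, h2, slashHom_apply, ← mul_assoc] at h
    exact h

end ModularLewis

/-- For `n ≥ 1` and `lam = ± 1`: the data `(c, b)`, hence `A_i`, and `k_i` exist and are unique, so
that `ψ_i` is meaningful; `(ψ_i)` solves the module Lewis system; and for every complex weight `s`
and every solution `φ` of the scalar Lewis equation, the functions `φ |_s ψ_i` are defined and
solve the vector Lewis equation. -/
theorem theorem1p1 (n : ℕ) (hn : 0 < n) (lam : ℤ) (hlam : lam = 1 ∨ lam = -1) :
    (∀ i : CosetSpace n, ∃! p : ℕ × ℕ, IsIndexPair n i p) ∧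
    (∀ i : CosetSpace n, ∃! k : ℕ, IsChainLength n (matA n i) k) ∧
    IsModuleSolution n lam (psi n) ∧
    ∀ (s : ℂ) (φ : ℂ → ℂ), IsScalarSolution lam s φ →
      (∀ i : CosetSpace n, ∀ A ∈ (psi n i).coeff.support, SlashDefined φ A) ∧
      IsVectorSolution n lam s (fun i => slashRing s φ (psi n i)) := by
  refine ⟨fun i => ?_, fun i => ?_, fun i => ?_, fun s φ hφ => ⟨fun i A hA => ?_, ?_⟩⟩
  · exact ⟨_, indexPair_spec hn i, fun p hp => isIndexPair_unique hp (indexPair_spec hn i)⟩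
  · exact ⟨_, chainLength_spec hn i, fun k hk => isChainLength_unique hk (chainLength_spec hn i)⟩
  · exact nonnegIdeal_le lam (psi_sub_mem_nonnegIdeal hn hlam i)
  · exact slashDefined_of_mem_setS hφ (mem_setS_of_mem_support_psi hn hA)
  · exact isVectorSolution_slashRing_psi hn hlam hφ
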